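/- Let $V^1$ be the two-sorted theory of bounded arithmetic over $\{0,1,+,\cdot,|\ |,=_1,=_2,\le,\in\}$ axiomatized by $2$-BASIC, comprehension for $\Sigma^{1,b}_0$-formulas and number induction for $\Sigma^{1,b}_1$-formulas. All objects below are coded by numbers and finite sets in $V^1$, with tuples coded by a pairing function that is a term of the language. An instance $\Theta=(\mathcal X,\ddot{\mathcal A})$ consists of numbers $n,l$, an input digraph $\mathcal X$ on $\{0,\dots,n-1\}$ with edge relation $E_{\mathcal X}$, and a target digraph with domains $\ddot{\mathcal A}$: domains $D_i\subseteq\{0,\dots,l-1\}$ ($i<n$) and relations $E^{ij}_{\ddot{\mathcal A}}\subseteq D_i\times D_j$ ($i,j<n$). Given $\Theta$, define \begin{itemize} \item $E^{ij}_{0}(a,b)\iff a\in D_i\wedge b\in D_j\wedge(E_{\mathcal X}(i,j)\to E^{ij}_{\ddot{\mathcal A}}(a,b))\wedge(E_{\mathcal X}(j,i)\to E^{ji}_{\ddot{\mathcal A}}(b,a))$; \item $Pr_1(i,a)\iff a\in D_i\wedge\forall j<n\,(E_{\mathcal X}(i,j)\to\exists b\in D_j\,E^{ij}_0(a,b))\wedge\forall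 k<n\,(E_{\mathcal X}(k,i)\to\exists c\in D_k\,E^{ki}_0(c,a))$; \item $R_1(i,j,a,b)\iff Pr_1(i,a)\wedge Pr_1(j,b)\wedge E^{ij}_0(a,b)$, and let $q$ be the number of elements of $R_1$, given by its census function; \item $R_{t+1}(i,j,a,b)\iff R_t(i,j,a,b)\wedge\forall k<n\,\exists c<l\,(Pr_1(k,c)\wedge R_t(i,k,a,c)\wedge R_t(k,j,c,b))$ for $1\le t\le q$; \item $Pr_{cc}(i,a)\iff Pr_1(i,a)\wedge\forall j<n\,(E_{\mathcal X}(i,j)\to\exists b\,(Pr_1(j,b)\wedge R_{q+1}(i,j,a,b)))\wedge\forall k<n\,(E_{\mathcal X}(k,i)\to\exists c\,(Pr_1(k,c)\wedge R_{q+1}(k,i,c,a)))$. \end{itemize} The propagated instance is $\Theta_{cc}=(\mathcal X,\ddot{\mathcal A}_{cc})$, where $\ddot{\mathcal A}_{cc}$ has the domains $V_{\ddot{\mathcal A}_{cc}}(i)=\{a: Pr_{cc}(i,a)\}$ and the relations $E^{ij}_{\ddot{\mathcal A}_{cc}}(a,b)\iff Pr_{cc}(i,a)\wedge Pr_{cc}(j,b)\wedge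 R_{q+1}(i,j,a,b)$. An undirected cycle of length $t\ge 2$ is a digraph $\mathcal C_t$ on $\{0,\dots,t-1\}$ in which any two cyclically consecutive vertices are joined by an edge in at least one of the two directions and which has no other edges. An instance with domains $D_i$ is $1$-consistent if for all $i,j<n$ and $a\in D_i$: $E_{\mathcal X}(i,j)$ implies $E^{ij}(a,b)$ for some $b\in D_j$, and $E_{\mathcal X}(j,i)$ implies $E^{ji}(b,a)$ for some $b\in D_j$. It is cycle-consistent if it is $1$-consistent and, for all $k<n$, $a\in D_k$, every undirected cycle $\mathcal C_t$ of any length $t\ge2$ and every homomorphism $H:\mathcal C_t\to\mathcal X$ with $H(0)=k$, there is a homomorphism $H'$ from $\mathcal C_t$ to the target digraph such that $H'(0)=\langle k,a\rangle$ and, for each $j<t$, $H'(j)=\langle H(j),b\rangle$ for some $b\in D_{H(j)}$. **Lemma.** $V^1$ proves: for every instance $\Theta$, the sets and the number $q$ in the definition of $\Theta_{cc}$ exist, and, whenever all the domains $V_{\ddot{\mathcal A}_{cc}}(i)$, $i<n$, are nonempty, the instance $\Theta_{cc}$ is cycle-consistent. -/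

import Mathlib

universe u v

namespace BoundedArith

/-! ### Two-sorted first-order logic over `{0, 1, +, ·, | |, =₁, =₂, ≤, ∈}` -/

/-- Number terms.  Variables of both sorts are named by natural numbers; the only terms of the set
sort are the set variables, and `len X` is the length `|X|` of the set variable `X`. -/
inductive NTerm : Type
  | var (x : ℕ)
  | zero
  | one
  | add (s t : NTerm)
  | mul (s t : NTerm)
  | len (X : ℕ)

instance : Zero NTerm := ⟨NTerm.zero⟩
instance : One NTerm := ⟨NTerm.one⟩
instance : Add NTerm := ⟨NTerm.add⟩
instance : Mul NTerm := ⟨NTerm.mul⟩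

/-- Two-sorted formulas. -/
inductive Formula : Type
  | eqN (s t : NTerm)
  | le (s t : NTerm)
  | mem (t : NTerm) (X : ℕ)
  | eqS (X Y : ℕ)
  | neg (φ : Formula)
  | and (φ ψ : Formula)
  | or (φ ψ : Formula)
  | allN (x : ℕ) (φ : Formula)
  | exN (x : ℕ) (φ : Formula)
  | allS (X : ℕ) (φ : Formula)
  | exS (X : ℕ) (φ : Formula)

/-- The number variables of a term. -/
def NTerm.nvars : NTerm → Finset ℕ
  | .var x => {x}
  | .zero => ∅
  | .one => ∅
  | .add s t => s.nvars ∪ t.nvars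
  | .mul s t => s.nvars ∪ t.nvars
  | .len _ => ∅

/-- The set variables of a term. -/
def NTerm.svars : NTerm → Finset ℕ
  | .var _ => ∅
  | .zero => ∅
  | .one => ∅
  | .add s t => s.svars ∪ t.svars
  | .mul s t => s.svars ∪ t.svars
  | .len X => {X}

/-- The free number variables of a formula. -/
def Formula.nfree : Formula → Finset ℕ
  | .eqN s t => s.nvars ∪ t.nvars
  | .le s t => s.nvars ∪ t.nvars
  | .mem t _ => t.nvars
  | .eqS _ _ => ∅
  | .neg φ => φ.nfree
  | .and φ ψ => φ.nfree ∪ ψ.nfree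
  | .or φ ψ => φ.nfree ∪ ψ.nfree
  | .allN x φ => φ.nfree.erase x
  | .exN x φ => φ.nfree.erase x
  | .allS _ φ => φ.nfree
  | .exS _ φ => φ.nfree

/-- The free set variables of a formula. -/
def Formula.sfree : Formula → Finset ℕ
  | .eqN s t => s.svars ∪ t.svars
  | .le s t => s.svars ∪ t.svars
  | .mem t X => insert X t.svars
  | .eqS X Y => {X, Y}
  | .neg φ => φ.sfree
  | .and φ ψ => φ.sfree ∪ ψ.sfree
  | .or φ ψ => φ.sfree ∪ ψ.sfree
  | .allN _ φ => φ.sfree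
  | .exN _ φ => φ.sfree
  | .allS X φ => φ.sfree.erase X
  | .exS X φ => φ.sfree.erase X

/-- A structure for the two-sorted language; both sorts are nonempty, both equality symbols are
interpreted by equality. -/
structure Structure where
  Num : Type u
  Str : Type v
  str_nonempty : Nonempty Str
  zero : Num
  one : Num
  add : Num → Num → Num
  mul : Num → Num → Num
  len : Str → Num
  le : Num → Num → Prop
  mem : Num → Str → Prop

/-- The value of a term under an assignment `σ` of numbers and `τ` of sets. -/
def NTerm.eval (M : Structure.{u, v}) (σ : ℕ → M.Num) (τ : ℕ → M.Str) : NTerm → M.Num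
  | .var x => σ x
  | .zero => M.zero
  | .one => M.one
  | .add s t => M.add (s.eval M σ τ) (t.eval M σ τ)
  | .mul s t => M.mul (s.eval M σ τ) (t.eval M σ τ)
  | .len X => M.len (τ X)

/-- Tarski's satisfaction relation. -/
def Formula.Realize (M : Structure.{u, v}) :
    Formula → (ℕ → M.Num) → (ℕ → M.Str) → Prop
  | .eqN s t, σ, τ => s.eval M σ τ = t.eval M σ τ
  | .le s t, σ, τ => M.le (s.eval M σ τ) (t.eval M σ τ)
  | .mem t X, σ, τ => M.mem (t.eval M σ τ) (τ X)
  | .eqS X Y, _, τ => τ X = τ Y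
  | .neg φ, σ, τ => ¬ φ.Realize M σ τ
  | .and φ ψ, σ, τ => φ.Realize M σ τ ∧ ψ.Realize M σ τ
  | .or φ ψ, σ, τ => φ.Realize M σ τ ∨ ψ.Realize M σ τ
  | .allN x φ, σ, τ => ∀ m : M.Num, φ.Realize M (Function.update σ x m) τ
  | .exN x φ, σ, τ => ∃ m : M.Num, φ.Realize M (Function.update σ x m) τ
  | .allS X φ, σ, τ => ∀ S : M.Str, φ.Realize M σ (Function.update τ X S)
  | .exS X φ, σ, τ => ∃ S : M.Str, φ.Realize M σ (Function.update τ X S)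

/-- The universal closure of `φ` holds in `M`. -/
def Structure.Valid (M : Structure.{u, v}) (φ : Formula) : Prop :=
  ∀ (σ : ℕ → M.Num) (τ : ℕ → M.Str), φ.Realize M σ τ

/-- `M` is a model of the universal closures of the formulas in `T`. -/
def Structure.Models (M : Structure.{u, v}) (T : Set Formula) : Prop :=
  ∀ φ ∈ T, M.Valid φ

/-- The theory axiomatized by `T` proves `φ`.  As usual for theories of bounded arithmetic (and for
first-order theories in Mathlib), a theory is the set of all logical consequences of its axioms:
`φ` holds in every model of `T`, standard or not. -/
def Proves (T : Set Formula) (φ : Formula) : Prop :=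
  ∀ M : Structure.{u, v}, M.Models T → M.Valid φ

/-! ### Abbreviations -/

namespace Formula

def imp (φ ψ : Formula) : Formula := or (neg φ) ψ

def iff (φ ψ : Formula) : Formula := and (imp φ ψ) (imp ψ φ)

/-- `s < t` -/
def lt (s t : NTerm) : Formula := and (le s t) (neg (eqN s t))

/-- `∀ x ≤ t, φ` -/
def allLe (x : ℕ) (t : NTerm) (φ : Formula) : Formula := allN x (imp (le (.var x) t) φ)

/-- `∃ x ≤ t, φ` -/
def exLe (x : ℕ) (t : NTerm) (φ : Formula) : Formula := exN x (and (le (.var x) t) φ)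

/-- `∀ X ≤ t, φ`, the bound is on the length of `X` -/
def allSLe (X : ℕ) (t : NTerm) (φ : Formula) : Formula := allS X (imp (le (.len X) t) φ)

/-- `∃ X ≤ t, φ`, the bound is on the length of `X` -/
def exSLe (X : ℕ) (t : NTerm) (φ : Formula) : Formula := exS X (and (le (.len X) t) φ)

end Formula

infixr:35 " ⋏ " => Formula.and
infixr:30 " ⋎ " => Formula.or
infixr:25 " ⟹ " => Formula.imp
infix:20 " ⟺ " => Formula.iff

/-! ### The theory `V¹` -/

/-- `Σ₀^{1,b}`: no set quantifiers, all number quantifiers bounded. -/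
inductive IsSigma0 : Formula → Prop
  | eqN (s t : NTerm) : IsSigma0 (.eqN s t)
  | le (s t : NTerm) : IsSigma0 (.le s t)
  | mem (t : NTerm) (X : ℕ) : IsSigma0 (.mem t X)
  | eqS (X Y : ℕ) : IsSigma0 (.eqS X Y)
  | neg {φ : Formula} : IsSigma0 φ → IsSigma0 (.neg φ)
  | and {φ ψ : Formula} : IsSigma0 φ → IsSigma0 ψ → IsSigma0 (.and φ ψ)
  | or {φ ψ : Formula} : IsSigma0 φ → IsSigma0 ψ → IsSigma0 (.or φ ψ)
  | allLe {x : ℕ} {t : NTerm} {φ : Formula} :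
      x ∉ t.nvars → IsSigma0 φ → IsSigma0 (.allLe x t φ)
  | exLe {x : ℕ} {t : NTerm} {φ : Formula} :
      x ∉ t.nvars → IsSigma0 φ → IsSigma0 (.exLe x t φ)

mutual

/-- `Σ₁^{1,b}` -/
inductive IsSigma1 : Formula → Prop
  | of_sigma0 {φ : Formula} : IsSigma0 φ → IsSigma1 φ
  | and {φ ψ : Formula} : IsSigma1 φ → IsSigma1 ψ → IsSigma1 (.and φ ψ)
  | or {φ ψ : Formula} : IsSigma1 φ → IsSigma1 ψ → IsSigma1 (.or φ ψ)
  | neg {φ : Formula} : IsPi1 φ → IsSigma1 (.neg φ)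
  | exSLe {X : ℕ} {t : NTerm} {φ : Formula} :
      X ∉ t.svars → IsSigma1 φ → IsSigma1 (.exSLe X t φ)

/-- `Π₁^{1,b}` -/
inductive IsPi1 : Formula → Prop
  | of_sigma0 {φ : Formula} : IsSigma0 φ → IsPi1 φ
  | and {φ ψ : Formula} : IsPi1 φ → IsPi1 ψ → IsPi1 (.and φ ψ)
  | or {φ ψ : Formula} : IsPi1 φ → IsPi1 ψ → IsPi1 (.or φ ψ)
  | neg {φ : Formula} : IsSigma1 φ → IsPi1 (.neg φ)
  | allSLe {X : ℕ} {t : NTerm} {φ : Formula} :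
      X ∉ t.svars → IsPi1 φ → IsPi1 (.allSLe X t φ)

end

open Formula in
/-- The axioms `2-BASIC` (number variables `x, y` are `0, 1`, set variables `X, Y` are `0, 1`). -/
inductive TwoBasic : Formula → Prop
  | b1 : TwoBasic (neg (eqN (.var 0 + 1) 0))
  | b2 : TwoBasic (eqN (.var 0 + 1) (.var 1 + 1) ⟹ eqN (.var 0) (.var 1))
  | b3 : TwoBasic (eqN (.var 0 + 0) (.var 0))
  | b4 : TwoBasic (eqN (.var 0 + (.var 1 + 1)) ((.var 0 + .var 1) + 1))
  | b5 : TwoBasic (eqN (.var 0 * 0) 0)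
  | b6 : TwoBasic (eqN (.var 0 * (.var 1 + 1)) (.var 0 * .var 1 + .var 0))
  | b7 : TwoBasic (le (.var 0) (.var 1) ⋏ le (.var 1) (.var 0) ⟹ eqN (.var 0) (.var 1))
  | b8 : TwoBasic (le (.var 0) (.var 0 + .var 1))
  | b9 : TwoBasic (le 0 (.var 0))
  | b10 : TwoBasic (le (.var 0) (.var 1) ⋎ le (.var 1) (.var 0))
  | b11 : TwoBasic (le (.var 0) (.var 1) ⟺ lt (.var 0) (.var 1 + 1))
  | b12 : TwoBasic (neg (eqN (.var 0) 0) ⟹ exLe 1 (.var 0) (eqN (.var 1 + 1) (.var 0)))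
  | l1 : TwoBasic (mem (.var 1) 0 ⟹ lt (.var 1) (.len 0))
  | l2 : TwoBasic (eqN (.var 1 + 1) (.len 0) ⟹ mem (.var 1) 0)
  | se : TwoBasic ((eqN (.len 0) (.len 1) ⋏
      allLe 0 (.len 0) (lt (.var 0) (.len 0) ⟹ (mem (.var 0) 0 ⟺ mem (.var 0) 1))) ⟺ eqS 0 1)

open Formula in
/-- `φ(t)` for the variable `x` of `φ`, written with an auxiliary variable `y` (which is neither
`x` nor a variable of `φ` or `t`) instead of a substitution: `∀ y (y = t → ∀ x (x = y → φ))`. -/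
def Formula.at (φ : Formula) (x y : ℕ) (t : NTerm) : Formula :=
  allN y (eqN (.var y) t ⟹ allN x (eqN (.var x) (.var y) ⟹ φ))

open Formula in
/-- Induction for `φ(x)`: `φ(0) ∧ ∀ x (φ(x) → φ(x + 1)) → ∀ x φ(x)`. -/
def indAxiom (φ : Formula) (x y : ℕ) : Formula :=
  φ.at x y 0 ⋏ allN x (φ ⟹ φ.at x y (.var x + 1)) ⟹ allN x φ

open Formula in
/-- Comprehension for `φ(y)`: `∀ x ∃ X ≤ x ∀ y < x (y ∈ X ↔ φ(y))`. -/
def compAxiom (φ : Formula) (x y X : ℕ) : Formula :=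
  allN x (exSLe X (.var x)
    (allLe y (.var x) (lt (.var y) (.var x) ⟹ (mem (.var y) X ⟺ φ))))

/-- The axioms of `V¹`: `2-BASIC`, comprehension for `Σ₀^{1,b}`-formulas and induction for
`Σ₁^{1,b}`-formulas. -/
inductive V1 : Set Formula
  | basic {φ : Formula} : TwoBasic φ → V1 φ
  | comp {φ : Formula} {x y X : ℕ} :
      IsSigma0 φ → x ≠ y → X ∉ φ.sfree → V1 (compAxiom φ x y X)
  | ind {φ : Formula} {x y : ℕ} :
      IsSigma1 φ → x ≠ y → y ∉ φ.nfree → V1 (indAxiom φ x y)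

/-! ### Coding of CSP instances

An input digraph with vertices `0, …, n - 1` is the number `n` and a set `EX` coding its edges.  A
target digraph with domains over the superdomain `{0, …, l - 1}` is a pair of sets `V`, `E`, where
`V(i,a)` says `a ∈ D_i` and `E(⟨i,a⟩,⟨j,b⟩)` says `(a,b) ∈ E^{ij}`.

Below, the first argument of a bounded number quantifier is the name of the bound variable, and the
body receives this variable as a term; the names `0, 1, 2` are kept for `n, l, q`. -/

open Formula

/-- `∀ x < t, φ(x)` -/
def allLt (x : ℕ) (t : NTerm) (φ : NTerm → Formula) : Formula :=
  allLe x t (lt (.var x) t ⟹ φ (.var x))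

/-- `∃ x < t, φ(x)` -/
def exLt (x : ℕ) (t : NTerm) (φ : NTerm → Formula) : Formula :=
  exLe x t (lt (.var x) t ⋏ φ (.var x))

/-- The pairing function as a term of the language: `⟨s,t⟩ = (s + t)(s + t + 1) + 2t`. -/
def pair (s t : NTerm) : NTerm := (s + t) * (s + t + 1) + (t + t)

/-- `X(s,t)` -/
def mem2 (X : ℕ) (s t : NTerm) : Formula := mem (pair s t) X

/-- `E^{ij}(a,b)`, that is `E(⟨i,a⟩,⟨j,b⟩)` -/
def edge (E : ℕ) (i j a b : NTerm) : Formula := mem2 E (pair i a) (pair j b)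

/-- `EX` is a binary relation on `{0, …, n - 1}`. -/
def isInputGraph (n : NTerm) (EX : ℕ) : Formula :=
  allLt 3 (.len EX) fun w => mem w EX ⟹
    exLt 4 n fun i => exLt 5 n fun j => eqN w (pair i j)

/-- `(V, E)` is a target digraph with domains `D_0, …, D_{n-1} ⊆ {0, …, l - 1}`. -/
def isTargetGraph (n l : NTerm) (V E : ℕ) : Formula :=
  le (.len V) (pair n l) ⋏
  (allLt 3 (.len V) fun u => mem u V ⟹
    exLt 4 n fun i => exLt 5 l fun a => eqN u (pair i a)) ⋏
  le (.len E) (pair (pair n l) (pair n l)) ⋏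
  (allLt 3 (.len E) fun w => mem w E ⟹
    exLt 4 n fun i => exLt 5 n fun j => exLt 6 l fun a => exLt 7 l fun b =>
      eqN w (pair (pair i a) (pair j b)) ⋏ mem2 V i a ⋏ mem2 V j b)

/-- `DG(Θ)`: `Θ = (X, Ä)` is an instance. -/
def isInstance (n l : NTerm) (EX V E : ℕ) : Formula :=
  isInputGraph n EX ⋏ isTargetGraph n l V E

/-! ### Cycle-consistency -/

/-- `1C(X, Ä)`: the instance is 1-consistent. -/
def oneConsistent (n l : NTerm) (EX V E : ℕ) : Formula :=
  allLt 3 n fun i => allLt 4 l fun a => mem2 V i a ⟹ allLt 5 n fun j =>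
    (mem2 EX i j ⟹ exLt 6 l fun b => mem2 V j b ⋏ edge E i j a b) ⋏
    (mem2 EX j i ⟹ exLt 6 l fun b => mem2 V j b ⋏ edge E j i b a)

/-- `CYCLE(C_t)`: the digraph on `{0, …, t - 1}` with edge set `EC` is an undirected cycle of
length `t ≥ 2`: cyclically consecutive vertices are joined by an edge in at least one direction, and
there are no other edges.  (A single loop is not counted as a cycle; loops of the input digraph may
be traversed by the image of a longer cycle.) -/
def isCycle (t : NTerm) (EC : ℕ) : Formula :=
  le (1 + 1) t ⋏
  (allLt 6 t fun s => eqN (s + 1) t ⟹ mem2 EC 0 s ⋎ mem2 EC s 0) ⋏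
  (allLt 6 t fun i => lt (i + 1) t ⟹ mem2 EC i (i + 1) ⋎ mem2 EC (i + 1) i) ⋏
  (allLt 6 t fun i => allLt 7 t fun j => mem2 EC i j ⟹
    eqN j (i + 1) ⋎ eqN i (j + 1) ⋎
    (eqN i 0 ⋏ eqN (j + 1) t) ⋎ (eqN j 0 ⋏ eqN (i + 1) t))

/-- `HOM(C_t, X, H)`: `H` is (the graph of) a homomorphism from the digraph `EC` on
`{0, …, t - 1}` to the input digraph. -/
def isHomInput (t n : NTerm) (EC EX H : ℕ) : Formula :=
  (allLt 6 t fun i => exLt 7 n fun j => mem2 H i j) ⋏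
  (allLt 6 t fun i => allLt 7 n fun j => allLt 8 n fun j' =>
    mem2 H i j ⋏ mem2 H i j' ⟹ eqN j j') ⋏
  (allLt 6 t fun i => allLt 7 t fun i' => allLt 8 n fun j => allLt 9 n fun j' =>
    mem2 EC i i' ⋏ mem2 H i j ⋏ mem2 H i' j' ⟹ mem2 EX j j')

/-- `H'` is (the graph of) a homomorphism from the digraph `EC` on `{0, …, t - 1}` to the digraph
with vertex set `V` and edge set `E`. -/
def isHomTarget (t n l : NTerm) (EC V E H' : ℕ) : Formula :=
  (allLt 6 t fun i => exLt 7 (pair n l) fun u => mem u V ⋏ mem2 H' i u) ⋏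
  (allLt 6 t fun i => allLt 7 (pair n l) fun u => allLt 8 (pair n l) fun u' =>
    mem2 H' i u ⋏ mem2 H' i u' ⟹ eqN u u') ⋏
  (allLt 6 t fun i => allLt 7 t fun i' => allLt 8 (pair n l) fun u => allLt 9 (pair n l) fun u' =>
    mem2 EC i i' ⋏ mem2 H' i u ⋏ mem2 H' i' u' ⟹ mem2 E u u')

/-- `CC(X, Ä)`: the instance is 1-consistent, and for every `k < n` and `a ∈ D_k`, every undirected
cycle (of any length `t`) with a homomorphism `H` to the input digraph with `H(0) = k` has a
homomorphism `H'` to the target digraph with `H'(0) = ⟨k,a⟩` and `H'(j) ∈ {H(j)} × D_{H(j)}`. -/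
def cycleConsistent (n l : NTerm) (EX V E : ℕ) (EC H H' : ℕ) : Formula :=
  oneConsistent n l EX V E ⋏
  allLt 3 n fun k => allLt 4 l fun a => mem2 V k a ⟹
    allN 5 (allS EC (allS H
      (isCycle (.var 5) EC ⋏ isHomInput (.var 5) n EC EX H ⋏ mem2 H 0 k ⟹
        exSLe H' (pair (.var 5) (pair n l))
          (isHomTarget (.var 5) n l EC V E H' ⋏
          (allLt 6 n fun i => allLt 7 (.var 5) fun j => mem2 H j i ⟹
            exLt 8 l fun b => mem2 V i b ⋏ mem2 H' j (pair i b)) ⋏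
          mem2 H' 0 (pair k a)))))

/-! ### The propagated instance `Θ_cc` -/

/-- `E^{ij}_{R₀}(a,b)`: the full relation on `D_i × D_j` intersected with the constraints on
`i, j`. -/
def edgeR0 (EX V E : ℕ) (i j a b : NTerm) : Formula :=
  mem2 V i a ⋏ mem2 V j b ⋏
  (mem2 EX i j ⟹ edge E i j a b) ⋏ (mem2 EX j i ⟹ edge E j i b a)

/-- `(V₁, E₁)` is the target digraph `R₁`: the domain `V₁(i)` is the intersection of the projections
of the relations of `R₀` to `i`, and `E₁` is the restriction of `R₀`. -/
def isR1 (n l : NTerm) (EX V E V₁ E₁ : ℕ) : Formula :=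
  isTargetGraph n l V₁ E₁ ⋏
  (allLt 3 n fun i => allLt 4 l fun a => mem2 V₁ i a ⟺
    mem2 V i a ⋏
    (allLt 5 n fun j => mem2 EX i j ⟹
      exLt 6 l fun b => mem2 V j b ⋏ edgeR0 EX V E i j a b) ⋏
    (allLt 5 n fun k => mem2 EX k i ⟹
      exLt 6 l fun c => mem2 V k c ⋏ edgeR0 EX V E k i c a)) ⋏
  (allLt 3 n fun i => allLt 4 n fun j => allLt 5 l fun a => allLt 6 l fun b =>
    edge E₁ i j a b ⟺ mem2 V₁ i a ⋏ mem2 V₁ j b ⋏ edgeR0 EX V E i j a b)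

/-- `C` is (the graph of) the census function of `X`: `C(x) = y` iff `X` has `y` elements
below `x`, for `x ≤ |X|`. -/
def isCensus (X C : ℕ) : Formula :=
  le (.len C) (pair (.len X) (.len X) + 1) ⋏
  mem2 C 0 0 ⋏
  (allLt 3 (.len X) fun x => allLt 4 (.len C) fun y => mem2 C x y ⟹
    (mem x X ⟹ mem2 C (x + 1) (y + 1)) ⋏ (neg (mem x X) ⟹ mem2 C (x + 1) y)) ⋏
  (allLt 3 (.len X + 1) fun x => allLt 4 (.len C) fun y => allLt 5 (.len C) fun z =>
    mem2 C x y ⋏ mem2 C x z ⟹ eqN y z)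

/-- `R_t(i,j,a,b)`: the rows of the set `R` are the successive relations of the propagation. -/
def row (R : ℕ) (t i j a b : NTerm) : Formula :=
  mem2 R t (pair (pair i a) (pair j b))

/-- `R` codes the relations `R_1, …, R_{q+1}` of the propagation that starts with `(V₁, E₁)`. -/
def isPropagation (n l q : NTerm) (V₁ E₁ R : ℕ) : Formula :=
  (allLt 3 n fun i => allLt 4 n fun j => allLt 5 l fun a => allLt 6 l fun b =>
    row R 1 i j a b ⟺ edge E₁ i j a b) ⋏
  (allLt 9 (q + 1) fun t => le 1 t ⟹
    allLt 3 n fun i => allLt 4 n fun j => allLt 5 l fun a => allLt 6 l fun b =>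
      row R (t + 1) i j a b ⟺
        row R t i j a b ⋏
        allLt 7 n fun k => exLt 8 l fun c =>
          mem2 V₁ k c ⋏ row R t i k a c ⋏ row R t k j c b)

/-- `(Vcc, Ecc)` is the target digraph `Ä_cc` read off from `R_{q+1}`. -/
def isAcc (n l q : NTerm) (EX V₁ R Vcc Ecc : ℕ) : Formula :=
  isTargetGraph n l Vcc Ecc ⋏
  (allLt 3 n fun i => allLt 4 l fun a => mem2 Vcc i a ⟺
    mem2 V₁ i a ⋏
    (allLt 5 n fun j => mem2 EX i j ⟹
      exLt 6 l fun b => mem2 V₁ j b ⋏ row R (q + 1) i j a b) ⋏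
    (allLt 5 n fun k => mem2 EX k i ⟹
      exLt 6 l fun c => mem2 V₁ k c ⋏ row R (q + 1) k i c a)) ⋏
  (allLt 3 n fun i => allLt 4 n fun j => allLt 5 l fun a => allLt 6 l fun b =>
    edge Ecc i j a b ⟺ mem2 Vcc i a ⋏ mem2 Vcc j b ⋏ row R (q + 1) i j a b)

/-- The whole computation of `Θ_cc` from `Θ`: the digraph `R₁ = (V₁, E₁)`, the number `q` of its
edges (with census function `C`), the propagation `R`, and `Ä_cc = (Vcc, Ecc)`. -/
def isPropagated (n l q : NTerm) (EX V E V₁ E₁ C R Vcc Ecc : ℕ) : Formula :=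
  isR1 n l EX V E V₁ E₁ ⋏
  isCensus E₁ C ⋏ mem2 C (.len E₁) q ⋏
  isPropagation n l q V₁ E₁ R ⋏
  isAcc n l q EX V₁ R Vcc Ecc

/-- Every domain is nonempty. -/
def domainsNonempty (n l : NTerm) (V : ℕ) : Formula :=
  allLt 3 n fun i => exLt 4 l fun a => mem2 V i a

/-- For all `n, l` and every instance `Θ` (coded by the sets `0, 1, 2`): the computation of `Θ_cc`
(the number `q` and the sets `3, …, 8`) exists, and for every such computation, if all domains of
`Θ_cc` are nonempty, then `Θ_cc` is cycle-consistent. -/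
def ccLemma : Formula :=
  allN 0 (allN 1 (allS 0 (allS 1 (allS 2 (isInstance (.var 0) (.var 1) 0 1 2 ⟹
    exN 2 (exS 3 (exS 4 (exS 5 (exS 6 (exS 7 (exS 8
      (isPropagated (.var 0) (.var 1) (.var 2) 0 1 2 3 4 5 6 7 8))))))) ⋏
    allN 2 (allS 3 (allS 4 (allS 5 (allS 6 (allS 7 (allS 8
      (isPropagated (.var 0) (.var 1) (.var 2) 0 1 2 3 4 5 6 7 8 ⋏
        domainsNonempty (.var 0) (.var 1) 7 ⟹
      cycleConsistent (.var 0) (.var 1) 0 7 8 9 10 11))))))))))))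

end BoundedArith

namespace BoundedArith

open Function Formula

/-! ### Coincidence and the two schemes, read in a structure -/

-- Provability is truth in all models, so the argument runs inside an arbitrary, possibly
-- nonstandard, model `M`. Induction makes the numbers a discretely ordered commutative semiring
-- with an injective pairing. No external counting or recursion is available: every recursion has to
-- be a set built by Σ₁ induction on "there is a bounded set coding the computation so far"
-- (`exists_set_induction`, and its dependent-choice form `exists_path`). This yields the census
-- function, hence `q`, and the rows of the propagation.
--
-- The heart of the matter is that R_{q+1} is closed under the propagation step
-- (`IsPropagation.closed`). If R_t ⊆ R_{t+1} for some 1 ≤ t ≤ q, the sequence is constant from t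
-- on. Otherwise R_1, …, R_{q+1} decreases strictly inside a set with q elements, and R_{q+1} is
-- empty. The model justifies the latter by a pigeonhole induction (`IsCensus.notMem_of_chain`): the
-- census is pushed along the chain as an injection of R_{t+1} into the numbers below q - t.
--
-- The relations are symmetric under exchanging (i,a) and (j,b). With closure this makes E_cc equal
-- to R_{q+1} and gives path consistency: every edge between (i,a) and (j,b) extends to a triangle
-- through any third index k (`Saturated`).
--
-- For a cycle through k and a value a, choose values vertex by vertex, keeping each chosen vertex
-- adjacent to (k,a). The triangle property supplies the next vertex, adjacent both to the current
-- one and to (k,a). At the last vertex the invariant itself is the edge that closes the cycle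
-- (`Saturated.cycleConsistent`).

theorem NTerm.eval_congr {M : Structure.{u, v}} {σ σ' : ℕ → M.Num} {τ τ' : ℕ → M.Str}
    (t : NTerm) (hσ : ∀ x ∈ t.nvars, σ x = σ' x) (hτ : ∀ X ∈ t.svars, τ X = τ' X) :
    t.eval M σ τ = t.eval M σ' τ' := by
  induction t with
  | var x => exact hσ x (by simp [NTerm.nvars])
  | zero => rfl
  | one => rfl
  | add s t hs ht | mul s t hs ht =>
    simp only [NTerm.nvars, NTerm.svars, Finset.mem_union] at hσ hτ
    simp only [NTerm.eval]
    rw [hs (fun x h => hσ x (.inl h)) (fun x h => hτ x (.inl h)),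
      ht (fun x h => hσ x (.inr h)) (fun x h => hτ x (.inr h))]
  | len X => simp [NTerm.eval, hτ X (by simp [NTerm.svars])]

/-- The axiom schemes and the bounded forms of induction derived below introduce auxiliary
variables; coincidence is what allows their values to be discarded. -/
theorem Formula.realize_congr {M : Structure.{u, v}} (φ : Formula) :
    ∀ {σ σ' : ℕ → M.Num} {τ τ' : ℕ → M.Str}, (∀ x ∈ φ.nfree, σ x = σ' x) →
      (∀ X ∈ φ.sfree, τ X = τ' X) → (φ.Realize M σ τ ↔ φ.Realize M σ' τ') := by
  induction φ with
  | eqN s t | le s t =>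
    intro σ σ' τ τ' hσ hτ
    simp only [nfree, sfree, Finset.mem_union] at hσ hτ
    simp only [Realize]
    rw [s.eval_congr (fun x h => hσ x (.inl h)) (fun x h => hτ x (.inl h)),
      t.eval_congr (fun x h => hσ x (.inr h)) (fun x h => hτ x (.inr h))]
  | mem t X =>
    intro σ σ' τ τ' hσ hτ
    simp only [nfree, sfree, Finset.mem_insert] at hσ hτ
    simp only [Realize]
    rw [t.eval_congr hσ (fun x h => hτ x (.inr h)), hτ X (.inl rfl)]
  | eqS X Y =>
    intro σ σ' τ τ' _ hτ
    simp only [Realize]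
    rw [hτ X (by simp [sfree]), hτ Y (by simp [sfree])]
  | neg φ ih =>
    intro σ σ' τ τ' hσ hτ
    simp only [Realize]
    rw [ih hσ hτ]
  | and φ ψ hφ hψ | or φ ψ hφ hψ =>
    intro σ σ' τ τ' hσ hτ
    simp only [nfree, sfree, Finset.mem_union] at hσ hτ
    simp only [Realize]
    rw [hφ (fun x h => hσ x (.inl h)) (fun x h => hτ x (.inl h)),
      hψ (fun x h => hσ x (.inr h)) (fun x h => hτ x (.inr h))]
  | allN x φ ih | exN x φ ih =>
    intro σ σ' τ τ' hσ hτ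
    simp only [nfree, sfree, Finset.mem_erase] at hσ hτ
    have h (m : M.Num) : φ.Realize M (update σ x m) τ ↔ φ.Realize M (update σ' x m) τ' := by
      refine ih (fun y hy => ?_) hτ
      by_cases hyx : y = x
      · simp [hyx]
      · simp [hyx, hσ y ⟨hyx, hy⟩]
    simp only [Realize, h]
  | allS X φ ih | exS X φ ih =>
    intro σ σ' τ τ' hσ hτ
    simp only [nfree, sfree, Finset.mem_erase] at hσ hτ
    have h (S : M.Str) : φ.Realize M σ (update τ X S) ↔ φ.Realize M σ' (update τ' X S) := by
      refine ih hσ (fun Y hY => ?_)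
      by_cases hYX : Y = X
      · simp [hYX]
      · simp [hYX, hτ Y ⟨hYX, hY⟩]
    simp only [Realize, h]

theorem exists_fresh (s : Finset ℕ) : ∃ x, x ∉ s := Infinite.exists_notMem_finset s

section Realize

variable {M : Structure.{u, v}} {σ : ℕ → M.Num} {τ : ℕ → M.Str}

theorem realize_imp {φ ψ : Formula} :
    (φ ⟹ ψ).Realize M σ τ ↔ (φ.Realize M σ τ → ψ.Realize M σ τ) := by
  simp only [imp, Realize, imp_iff_not_or]

theorem realize_iff {φ ψ : Formula} :
    (φ ⟺ ψ).Realize M σ τ ↔ (φ.Realize M σ τ ↔ ψ.Realize M σ τ) := by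
  simp only [Formula.iff, Realize, realize_imp, iff_iff_implies_and_implies]

end Realize

-- Membership in Σ₀^{1,b} as rewriting rules, so that `simp` can decide it.

theorem isSigma0_eqN {s t : NTerm} : IsSigma0 (.eqN s t) ↔ True := iff_true_intro (.eqN s t)

theorem isSigma0_le {s t : NTerm} : IsSigma0 (.le s t) ↔ True := iff_true_intro (.le s t)

theorem isSigma0_mem {t : NTerm} {X : ℕ} : IsSigma0 (.mem t X) ↔ True :=
  iff_true_intro (.mem t X)

theorem isSigma0_neg {φ : Formula} : IsSigma0 (.neg φ) ↔ IsSigma0 φ :=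
  ⟨fun h => by cases h; assumption, .neg⟩

theorem isSigma0_and {φ ψ : Formula} : IsSigma0 (φ ⋏ ψ) ↔ IsSigma0 φ ∧ IsSigma0 ψ :=
  ⟨fun h => by cases h; exact ⟨‹_›, ‹_›⟩, fun h => .and h.1 h.2⟩

theorem isSigma0_or {φ ψ : Formula} : IsSigma0 (φ ⋎ ψ) ↔ IsSigma0 φ ∧ IsSigma0 ψ :=
  ⟨fun h => by cases h; exact ⟨‹_›, ‹_›⟩, fun h => .or h.1 h.2⟩

theorem isSigma0_imp {φ ψ : Formula} : IsSigma0 (φ ⟹ ψ) ↔ IsSigma0 φ ∧ IsSigma0 ψ := by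
  rw [imp, isSigma0_or, isSigma0_neg]

theorem isSigma0_iff {φ ψ : Formula} : IsSigma0 (φ ⟺ ψ) ↔ IsSigma0 φ ∧ IsSigma0 ψ := by
  rw [Formula.iff, isSigma0_and, isSigma0_imp, isSigma0_imp, and_comm (a := IsSigma0 ψ), and_self]

theorem isSigma0_lt {s t : NTerm} : IsSigma0 (.lt s t) ↔ True :=
  iff_true_intro (.and (.le s t) (.neg (.eqN s t)))

theorem isSigma0_allLe {x : ℕ} {t : NTerm} {φ : Formula} :
    IsSigma0 (.allLe x t φ) ↔ x ∉ t.nvars ∧ IsSigma0 φ :=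
  ⟨fun h => by cases h; exact ⟨‹_›, ‹_›⟩, fun h => .allLe h.1 h.2⟩

theorem isSigma0_exLe {x : ℕ} {t : NTerm} {φ : Formula} :
    IsSigma0 (.exLe x t φ) ↔ x ∉ t.nvars ∧ IsSigma0 φ :=
  ⟨fun h => by cases h; exact ⟨‹_›, ‹_›⟩, fun h => .exLe h.1 h.2⟩

theorem isSigma0_allLt {x : ℕ} {t : NTerm} {φ : NTerm → Formula} :
    IsSigma0 (allLt x t φ) ↔ x ∉ t.nvars ∧ IsSigma0 (φ (.var x)) := by
  rw [allLt, isSigma0_allLe, isSigma0_imp, isSigma0_lt, true_and]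

theorem isSigma0_exLt {x : ℕ} {t : NTerm} {φ : NTerm → Formula} :
    IsSigma0 (exLt x t φ) ↔ x ∉ t.nvars ∧ IsSigma0 (φ (.var x)) := by
  rw [exLt, isSigma0_exLe, isSigma0_and, isSigma0_lt, true_and]

theorem NTerm.nvars_var (x : ℕ) : (NTerm.var x).nvars = {x} := rfl

theorem NTerm.nvars_len (X : ℕ) : (NTerm.len X).nvars = ∅ := rfl

theorem NTerm.nvars_add (s t : NTerm) : (s + t).nvars = s.nvars ∪ t.nvars := rfl

theorem NTerm.nvars_mul (s t : NTerm) : (s * t).nvars = s.nvars ∪ t.nvars := rfl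

theorem NTerm.nvars_zero : (0 : NTerm).nvars = ∅ := rfl

theorem NTerm.nvars_one : (1 : NTerm).nvars = ∅ := rfl

theorem NTerm.mem_nvars_pair {x : ℕ} {s t : NTerm} :
    x ∈ (pair s t).nvars ↔ x ∈ s.nvars ∨ x ∈ t.nvars := by
  simp only [pair, nvars_add, nvars_mul, nvars_one, Finset.mem_union]
  tauto

-- Evaluation and satisfaction in a structure as rewriting rules.

namespace Model

variable {M : Structure.{u, v}}

instance : Zero M.Num := ⟨M.zero⟩
instance : One M.Num := ⟨M.one⟩
instance : Add M.Num := ⟨M.add⟩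
instance : Mul M.Num := ⟨M.mul⟩
instance : LE M.Num := ⟨M.le⟩

section Eval

variable {σ : ℕ → M.Num} {τ : ℕ → M.Str} {s t : NTerm}

theorem eval_zero : (0 : NTerm).eval M σ τ = 0 := rfl

theorem eval_one : (1 : NTerm).eval M σ τ = 1 := rfl

theorem eval_add : (s + t).eval M σ τ = s.eval M σ τ + t.eval M σ τ := rfl

theorem eval_mul : (s * t).eval M σ τ = s.eval M σ τ * t.eval M σ τ := rfl

theorem eval_var {x : ℕ} : (NTerm.var x).eval M σ τ = σ x := rfl

theorem realize_eqN : (Formula.eqN s t).Realize M σ τ ↔ s.eval M σ τ = t.eval M σ τ := Iff.rfl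

theorem realize_le : (Formula.le s t).Realize M σ τ ↔ s.eval M σ τ ≤ t.eval M σ τ := Iff.rfl

theorem realize_mem {X : ℕ} : (Formula.mem t X).Realize M σ τ ↔ M.mem (t.eval M σ τ) (τ X) :=
  Iff.rfl

theorem realize_neg {φ : Formula} : (Formula.neg φ).Realize M σ τ ↔ ¬ φ.Realize M σ τ := Iff.rfl

theorem realize_and {φ ψ : Formula} :
    (φ ⋏ ψ).Realize M σ τ ↔ φ.Realize M σ τ ∧ ψ.Realize M σ τ := Iff.rfl

theorem realize_or {φ ψ : Formula} :
    (φ ⋎ ψ).Realize M σ τ ↔ φ.Realize M σ τ ∨ ψ.Realize M σ τ := Iff.rfl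

theorem realize_allN {x : ℕ} {φ : Formula} :
    (Formula.allN x φ).Realize M σ τ ↔ ∀ m, φ.Realize M (update σ x m) τ := Iff.rfl

theorem realize_exN {x : ℕ} {φ : Formula} :
    (Formula.exN x φ).Realize M σ τ ↔ ∃ m, φ.Realize M (update σ x m) τ := Iff.rfl

theorem realize_allS {X : ℕ} {φ : Formula} :
    (Formula.allS X φ).Realize M σ τ ↔ ∀ S, φ.Realize M σ (update τ X S) := Iff.rfl

theorem realize_exS {X : ℕ} {φ : Formula} :
    (Formula.exS X φ).Realize M σ τ ↔ ∃ S, φ.Realize M σ (update τ X S) := Iff.rfl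

theorem eval_len {X : ℕ} : (NTerm.len X).eval M σ τ = M.len (τ X) := rfl

end Eval

/-- The value of the pairing term. -/
def npair (a b : M.Num) : M.Num := (a + b) * (a + b + 1) + (b + b)

/-- `E^{ij}(a,b)` in a model. -/
def Edge (E : M.Str) (i j a b : M.Num) : Prop := M.mem (npair (npair i a) (npair j b)) E

/-- `R_t(i,j,a,b)` in a model. -/
def Row (R : M.Str) (t i j a b : M.Num) : Prop := M.mem (npair t (npair (npair i a) (npair j b))) R

/-- `E^{ij}_{R₀}(a,b)` in a model. -/
def EdgeR0 (EX V E : M.Str) (i j a b : M.Num) : Prop :=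
  M.mem (npair i a) V ∧ M.mem (npair j b) V ∧
  (M.mem (npair i j) EX → Edge E i j a b) ∧ (M.mem (npair j i) EX → Edge E j i b a)

theorem EdgeR0.symm {EX V E : M.Str} {i j a b : M.Num} (h : EdgeR0 EX V E i j a b) :
    EdgeR0 EX V E j i b a :=
  ⟨h.2.1, h.1, h.2.2.2, h.2.2.1⟩

section Realize

variable {σ : ℕ → M.Num} {τ : ℕ → M.Str} {s t i j a b : NTerm} {EX V E R : ℕ}

@[simp] theorem eval_pair : (pair s t).eval M σ τ = npair (s.eval M σ τ) (t.eval M σ τ) := rfl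

@[simp] theorem realize_mem2 {X : ℕ} :
    (mem2 X s t).Realize M σ τ ↔ M.mem (npair (s.eval M σ τ) (t.eval M σ τ)) (τ X) := Iff.rfl

@[simp] theorem realize_edge : (edge E i j a b).Realize M σ τ ↔
    Edge (τ E) (i.eval M σ τ) (j.eval M σ τ) (a.eval M σ τ) (b.eval M σ τ) := Iff.rfl

@[simp] theorem realize_row : (row R t i j a b).Realize M σ τ ↔
    Row (τ R) (t.eval M σ τ) (i.eval M σ τ) (j.eval M σ τ) (a.eval M σ τ) (b.eval M σ τ) := Iff.rfl

@[simp] theorem realize_edgeR0 : (edgeR0 EX V E i j a b).Realize M σ τ ↔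
    EdgeR0 (τ EX) (τ V) (τ E) (i.eval M σ τ) (j.eval M σ τ) (a.eval M σ τ) (b.eval M σ τ) := by
  simp [edgeR0, EdgeR0, realize_and, realize_imp]

end Realize

end Model

/-- `M` is a model of `V¹`. -/
class IsModelV1 (M : Structure.{u, v}) : Prop where
  models : M.Models V1

-- Induction and comprehension as statements about a model.

section Schemes

variable {M : Structure.{u, v}} [hM : IsModelV1 M]

/-- The axiom replaces substitution by `Formula.at` with an auxiliary variable y; taking y fresh for
φ, its value drops out by coincidence. -/
theorem realize_induction {φ : Formula} (hφ : IsSigma1 φ) (x : ℕ) (σ : ℕ → M.Num) (τ : ℕ → M.Str)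
    (zero : φ.Realize M (update σ x 0) τ)
    (succ : ∀ m, φ.Realize M (update σ x m) τ → φ.Realize M (update σ x (m + 1)) τ)
    (m : M.Num) : φ.Realize M (update σ x m) τ := by
  obtain ⟨y, hy⟩ := exists_fresh (insert x φ.nfree)
  simp only [Finset.mem_insert, not_or] at hy
  have key (σ' : ℕ → M.Num) (hσ' : ∀ z, z ≠ x → z ≠ y → σ' z = σ z) (c : M.Num) :
      φ.Realize M (update σ' x c) τ ↔ φ.Realize M (update σ x c) τ := by
    refine φ.realize_congr (fun z hz => ?_) (fun _ _ => rfl)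
    by_cases hzx : z = x
    · simp [hzx]
    · simp only [update_of_ne hzx]
      exact hσ' z hzx (by rintro rfl; exact hy.2 hz)
  have h := hM.models _ (V1.ind hφ (Ne.symm hy.1) hy.2) σ τ
  simp only [indAxiom, Formula.at, realize_imp, Realize, NTerm.eval] at h
  refine h ⟨?_, ?_⟩ m
  · intro c hc d hd
    rw [key _ (fun z _ hz => by simp [hz])]
    simp only [update_self] at hc hd
    rw [update_of_ne hy.1, update_self] at hd
    rw [hd, hc]; exact zero
  · intro c hc d hd e he
    rw [key _ (fun z hzx hz => by simp [hz, hzx])]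
    simp only [update_self] at hd he
    rw [update_of_ne hy.1, update_self] at he
    rw [he, hd]
    convert succ c hc
    rw [update_of_ne (Ne.symm hy.1), update_self]
    rfl

theorem realize_comprehension {φ : Formula} (hφ : IsSigma0 φ) (y : ℕ) (σ : ℕ → M.Num)
    (τ : ℕ → M.Str) (b : M.Num) :
    ∃ S, M.len S ≤ b ∧
      ∀ m, m ≤ b → m ≠ b → (M.mem m S ↔ φ.Realize M (update σ y m) τ) := by
  obtain ⟨x, hx⟩ := exists_fresh (insert y φ.nfree)
  obtain ⟨X, hX⟩ := exists_fresh φ.sfree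
  simp only [Finset.mem_insert, not_or] at hx
  have h := hM.models _ (V1.comp hφ hx.1 hX) σ τ
  simp only [compAxiom, exSLe, allLe, lt, realize_imp, realize_iff, Realize, NTerm.eval,
    update_self] at h
  obtain ⟨S, hS, h⟩ := h b
  refine ⟨S, hS, fun m hm hmb => ?_⟩
  have h' := h m
  rw [update_of_ne hx.1, update_self] at h'
  rw [h' hm ⟨hm, hmb⟩]
  refine φ.realize_congr (fun z hz => ?_) (fun z hz => ?_)
  · by_cases hzy : z = y
    · simp [hzy]
    · have hzx : z ≠ x := by rintro rfl; exact hx.2 hz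
      simp [hzy, hzx]
  · exact update_of_ne (by rintro rfl; exact hX hz) _ _

end Schemes

/-! ### Arithmetic in a model of `V¹` -/

namespace Model

variable {M : Structure.{u, v}} [hM : IsModelV1 M]

theorem realize_basic {φ : Formula} (h : TwoBasic φ) (a b : M.Num) (τ : ℕ → M.Str) :
    φ.Realize M (update (fun _ => b) 0 a) τ := hM.models _ (V1.basic h) _ _

theorem realize_basic' {φ : Formula} (h : TwoBasic φ) (a b : M.Num) :
    φ.Realize M (update (fun _ => b) 0 a) fun _ => Classical.choice M.str_nonempty :=
  realize_basic h _ _ _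

theorem add_one_ne_zero (a : M.Num) : a + 1 ≠ 0 := realize_basic' .b1 a a

theorem add_one_inj {a b : M.Num} (h : a + 1 = b + 1) : a = b :=
  realize_imp.1 (realize_basic' .b2 a b) h

theorem num_add_zero (a : M.Num) : a + 0 = a := realize_basic' .b3 a a

theorem add_add_one (a b : M.Num) : a + (b + 1) = a + b + 1 := realize_basic' .b4 a b

theorem num_mul_zero (a : M.Num) : a * 0 = 0 := realize_basic' .b5 a a

theorem mul_add_one' (a b : M.Num) : a * (b + 1) = a * b + a := realize_basic' .b6 a b

theorem num_le_antisymm {a b : M.Num} (h : a ≤ b) (h' : b ≤ a) : a = b :=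
  realize_imp.1 (realize_basic' .b7 a b) ⟨h, h'⟩

theorem num_le_add (a b : M.Num) : a ≤ a + b := realize_basic' .b8 a b

theorem num_zero_le (a : M.Num) : 0 ≤ a := realize_basic' .b9 a a

theorem num_le_total (a b : M.Num) : a ≤ b ∨ b ≤ a := realize_basic' .b10 a b

theorem le_iff_le_add_one (a b : M.Num) : a ≤ b ↔ a ≤ b + 1 ∧ a ≠ b + 1 :=
  realize_iff.1 (realize_basic' .b11 a b)

/-- The engine for the semiring laws: induction on variable 0 in an equation, with parameters stored
in the variables 1 and 2 and an irrelevant set assignment. -/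
theorem eq_of_induction (s t : NTerm) (σ : ℕ → M.Num) (τ : ℕ → M.Str)
    (zero : s.eval M (update σ 0 0) τ = t.eval M (update σ 0 0) τ)
    (succ : ∀ m, s.eval M (update σ 0 m) τ = t.eval M (update σ 0 m) τ →
      s.eval M (update σ 0 (m + 1)) τ = t.eval M (update σ 0 (m + 1)) τ) (m : M.Num) :
    s.eval M (update σ 0 m) τ = t.eval M (update σ 0 m) τ :=
  realize_induction (.of_sigma0 (.eqN s t)) 0 σ τ zero succ m

theorem num_add_assoc (a b c : M.Num) : a + b + c = a + (b + c) := by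
  have := eq_of_induction (.var 1 + .var 2 + .var 0) (.var 1 + (.var 2 + .var 0))
    (update (fun _ => a) 2 b) (fun _ => Classical.choice M.str_nonempty)
  simp [eval_add, eval_var, num_add_zero, add_add_one] at this
  exact this (fun m h => by rw [h]) c

theorem num_zero_add (a : M.Num) : 0 + a = a := by
  have := eq_of_induction (0 + .var 0) (.var 0)
    (fun _ => a) (fun _ => Classical.choice M.str_nonempty)
  simp [eval_add, eval_var, eval_zero, num_add_zero, add_add_one] at this
  exact this (fun m h => by rw [h]) a

theorem add_one_add (a b : M.Num) : a + 1 + b = a + b + 1 := by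
  have := eq_of_induction (.var 1 + 1 + .var 0) (.var 1 + .var 0 + 1)
    (fun _ => a) (fun _ => Classical.choice M.str_nonempty)
  simp [eval_add, eval_var, eval_one, num_add_zero, add_add_one] at this
  exact this (fun m h => by rw [h]) b

theorem num_add_comm (a b : M.Num) : a + b = b + a := by
  have := eq_of_induction (.var 1 + .var 0) (.var 0 + .var 1)
    (fun _ => a) (fun _ => Classical.choice M.str_nonempty)
  simp [eval_add, eval_var, num_add_zero, num_zero_add, add_add_one, add_one_add] at this
  exact this (fun m h => by rw [h]) b

theorem num_zero_mul (a : M.Num) : 0 * a = 0 := by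
  have := eq_of_induction (0 * .var 0) 0
    (fun _ => a) (fun _ => Classical.choice M.str_nonempty)
  simp [eval_mul, eval_var, eval_zero, num_mul_zero, num_add_zero, mul_add_one'] at this
  exact this a

theorem add_one_mul' (a b : M.Num) : (a + 1) * b = a * b + b := by
  have := eq_of_induction ((.var 1 + 1) * .var 0) (.var 1 * .var 0 + .var 0)
    (fun _ => a) (fun _ => Classical.choice M.str_nonempty)
  simp [eval_mul, eval_add, eval_var, eval_one, num_mul_zero, num_add_zero, mul_add_one'] at this
  refine this (fun m h => ?_) b
  rw [h, ← num_add_assoc, ← num_add_assoc, num_add_assoc (a * m), num_add_comm m a, ← num_add_assoc]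

theorem num_mul_comm (a b : M.Num) : a * b = b * a := by
  have := eq_of_induction (.var 1 * .var 0) (.var 0 * .var 1)
    (fun _ => a) (fun _ => Classical.choice M.str_nonempty)
  simp [eval_mul, eval_var, num_mul_zero, num_zero_mul, mul_add_one', add_one_mul'] at this
  exact this (fun m h => by rw [h]) b

theorem num_mul_add (a b c : M.Num) : a * (b + c) = a * b + a * c := by
  have := eq_of_induction (.var 1 * (.var 2 + .var 0)) (.var 1 * .var 2 + .var 1 * .var 0)
    (update (fun _ => a) 2 b) (fun _ => Classical.choice M.str_nonempty)
  simp [eval_mul, eval_add, eval_var, num_mul_zero, num_add_zero, mul_add_one',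
    add_add_one] at this
  exact this (fun m h => by rw [h, num_add_assoc]) c

theorem num_mul_one (a : M.Num) : a * 1 = a := by
  rw [← num_zero_add (1 : M.Num), mul_add_one', num_mul_zero, num_zero_add]

theorem num_mul_assoc (a b c : M.Num) : a * b * c = a * (b * c) := by
  have := eq_of_induction (.var 1 * .var 2 * .var 0) (.var 1 * (.var 2 * .var 0))
    (update (fun _ => a) 2 b) (fun _ => Classical.choice M.str_nonempty)
  simp [eval_mul, eval_var, num_mul_zero, num_mul_add, num_mul_one] at this
  exact this (fun m h => by rw [h]) c

instance : CommSemiring M.Num where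
  add_assoc := num_add_assoc
  zero_add := num_zero_add
  add_zero := num_add_zero
  add_comm := num_add_comm
  mul_assoc := num_mul_assoc
  mul_comm := num_mul_comm
  one_mul a := by rw [num_mul_comm, num_mul_one]
  mul_one := num_mul_one
  left_distrib := num_mul_add
  right_distrib a b c := by rw [num_mul_comm, num_mul_add, num_mul_comm c, num_mul_comm c]
  zero_mul := num_zero_mul
  mul_zero := num_mul_zero
  nsmul := nsmulRec
  npow := npowRec

theorem num_add_right_cancel {a b c : M.Num} : a + c = b + c → a = b := by
  have := realize_induction (φ := eqN (.var 1 + .var 0) (.var 2 + .var 0) ⟹ eqN (.var 1) (.var 2))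
    (.of_sigma0 (.or (.neg (.eqN _ _)) (.eqN _ _))) 0 (update (fun _ => a) 2 b)
    (fun _ => Classical.choice M.str_nonempty)
  simp only [realize_imp, realize_eqN, eval_add, eval_var] at this
  simp at this
  refine this (fun m h h' => h ?_) c
  rw [← add_assoc, ← add_assoc] at h'
  exact add_one_inj h'

/-- The axioms give only a ≤ a + b; subtraction comes from induction on b, where axiom `b11` splits
a ≤ m + 1 into a = m + 1 and a ≤ m. The bound on the difference is there to keep the induction
formula Σ₀. -/
theorem exists_add_of_num_le {a b : M.Num} : a ≤ b → ∃ c, a + c = b := by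
  have := realize_induction
    (φ := le (.var 1) (.var 0) ⟹ exLe 2 (.var 0) (eqN (.var 1 + .var 2) (.var 0)))
    (.of_sigma0 (.or (.neg (.le _ _)) (.exLe (by simp [NTerm.nvars]) (.eqN _ _)))) 0 (fun _ => a)
    (fun _ => Classical.choice M.str_nonempty)
  simp only [realize_imp, exLe, realize_exN, realize_and, realize_le, realize_eqN, eval_add,
    eval_var] at this
  simp at this
  refine fun h => (this (fun h => ?_) (fun m ih h => ?_) b h).imp fun _ h => h.2
  · exact ⟨0, num_zero_le _, by rw [add_zero]; exact num_le_antisymm h (num_zero_le _)⟩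
  · by_cases hm : a = m + 1
    · exact ⟨0, num_zero_le _, by rw [add_zero, hm]⟩
    · obtain ⟨c, _, hc⟩ := ih ((le_iff_le_add_one _ _).2 ⟨h, hm⟩)
      refine ⟨c + 1, ?_, by rw [← add_assoc, hc]⟩
      rw [← hc, add_comm a c, add_right_comm]
      exact num_le_add _ _

theorem num_le_iff {a b : M.Num} : a ≤ b ↔ ∃ c, b = a + c :=
  ⟨fun h => (exists_add_of_num_le h).imp fun _ => Eq.symm, by rintro ⟨c, rfl⟩; exact num_le_add a c⟩

open Classical in
noncomputable instance : LinearOrder M.Num where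
  le_refl a := by simpa using num_le_add a 0
  le_trans a b c h h' := by
    obtain ⟨d, rfl⟩ := num_le_iff.1 h
    obtain ⟨e, rfl⟩ := num_le_iff.1 h'
    rw [add_assoc]
    exact num_le_add _ _
  le_antisymm _ _ := num_le_antisymm
  le_total := num_le_total
  toDecidableLE := inferInstance

instance : CanonicallyOrderedAdd M.Num where
  exists_add_of_le h := num_le_iff.1 h
  le_self_add := num_le_add
  le_add_self a b := by rw [add_comm]; exact num_le_add a b

instance : IsOrderedCancelAddMonoid M.Num where
  add_le_add_left a b h c := by
    obtain ⟨d, rfl⟩ := num_le_iff.1 h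
    rw [add_right_comm]
    exact num_le_add _ _
  le_of_add_le_add_left a b c h := by
    obtain ⟨d, hd⟩ := num_le_iff.1 h
    refine num_le_iff.2 ⟨d, num_add_right_cancel (c := a) ?_⟩
    rw [add_comm, hd]
    ring

theorem lt_add_one_iff {a b : M.Num} : a < b + 1 ↔ a ≤ b := by
  rw [lt_iff_le_and_ne, ← le_iff_le_add_one]

theorem add_one_le_iff {a b : M.Num} : a + 1 ≤ b ↔ a < b := by
  rw [← not_lt, lt_add_one_iff, not_le]

theorem exists_eq_add_one_of_lt {a b : M.Num} (h : a < b) : ∃ c, b = a + c + 1 := by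
  obtain ⟨c, rfl⟩ := num_le_iff.1 (add_one_le_iff.2 h)
  exact ⟨c, by ring⟩

theorem num_zero_lt_one : (0 : M.Num) < 1 := by
  simpa using (lt_add_one_iff (a := (0 : M.Num)) (b := 0)).2 le_rfl

instance : IsStrictOrderedRing M.Num where
  add_le_add_left a b h c := add_le_add_left h c
  le_of_add_le_add_left a b c h := le_of_add_le_add_left h
  zero_le_one := num_zero_le 1
  exists_pair_ne := ⟨0, 1, num_zero_lt_one.ne⟩
  mul_lt_mul_of_pos_left a ha b c h := by
    obtain ⟨a, rfl⟩ := exists_eq_add_one_of_lt ha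
    obtain ⟨d, rfl⟩ := exists_eq_add_one_of_lt h
    refine add_one_le_iff.1 (num_le_iff.2 ⟨a * d + a + d, by ring⟩)
  mul_lt_mul_of_pos_right a ha b c h := by
    obtain ⟨a, rfl⟩ := exists_eq_add_one_of_lt ha
    obtain ⟨d, rfl⟩ := exists_eq_add_one_of_lt h
    refine add_one_le_iff.1 (num_le_iff.2 ⟨a * d + a + d, by ring⟩)

end Model

attribute [simp] isSigma0_eqN isSigma0_le isSigma0_mem isSigma0_neg isSigma0_and isSigma0_or
  isSigma0_imp isSigma0_iff isSigma0_lt isSigma0_allLt isSigma0_exLt NTerm.nvars_var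
  NTerm.nvars_len NTerm.nvars_add NTerm.nvars_mul NTerm.nvars_zero NTerm.nvars_one
  NTerm.mem_nvars_pair realize_imp realize_iff

namespace Model

attribute [simp] eval_zero eval_one eval_add eval_mul eval_var eval_len realize_eqN realize_le
  realize_mem realize_neg realize_and realize_or

variable {M : Structure.{u, v}} [hM : IsModelV1 M]

/-! ### Pairing -/

/-- Pairs with sum s have codes between s(s+1) and s(s+1) + 2s, which is below (s+1)(s+2). So the
code determines the sum, and then the second component. -/
theorem npair_inj {a b c d : M.Num} : npair a b = npair c d ↔ a = c ∧ b = d := by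
  have aux {a b c d : M.Num} (h : a + b < c + d) : npair a b < npair c d := by
    obtain ⟨e, he⟩ := exists_eq_add_one_of_lt h
    unfold npair
    rw [he]
    refine add_one_le_iff.1 (num_le_iff.2
      ⟨2 * (a + b) * e + e * e + 2 * a + 3 * e + 1 + 2 * d, ?_⟩)
    ring
  refine ⟨fun h => ?_, by rintro ⟨rfl, rfl⟩; rfl⟩
  have hs : a + b = c + d := by
    rcases lt_trichotomy (a + b) (c + d) with h' | h' | h'
    · exact absurd h (aux h').ne
    · exact h'
    · exact absurd h (aux h').ne'
  have hb : b = d := by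
    unfold npair at h
    rw [hs] at h
    grind
  subst hb
  exact ⟨add_right_cancel hs, rfl⟩

theorem npair_le_npair {a b c d : M.Num} (h : a ≤ c) (h' : b ≤ d) : npair a b ≤ npair c d := by
  unfold npair
  gcongr

theorem npair_lt_npair {a b c d : M.Num} (h : a < c) (h' : b ≤ d) : npair a b < npair c d := by
  have h1 : a + b < c + d := add_lt_add_of_lt_of_le h h'
  unfold npair
  refine add_lt_add_of_lt_of_le ?_ (add_le_add h' h')
  exact mul_lt_mul h1 (by gcongr) (by positivity) zero_le

theorem le_npair_left (a b : M.Num) : a ≤ npair a b := by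
  refine num_le_iff.2 ⟨(a + b) * (a + b) + b + b + b, ?_⟩
  unfold npair
  ring

theorem le_npair_right (a b : M.Num) : b ≤ npair a b := by
  refine num_le_iff.2 ⟨(a + b) * (a + b) + a + b + b, ?_⟩
  unfold npair
  ring

/-! ### Semantics of the abbreviations -/

section Realize

variable {σ : ℕ → M.Num} {τ : ℕ → M.Str} {s t : NTerm}

@[simp] theorem realize_lt : (lt s t).Realize M σ τ ↔ s.eval M σ τ < t.eval M σ τ := by
  simp [lt, lt_iff_le_and_ne]

@[simp] theorem realize_allLt {x : ℕ} {φ : NTerm → Formula} : (allLt x t φ).Realize M σ τ ↔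
    ∀ m, m < t.eval M (update σ x m) τ → (φ (.var x)).Realize M (update σ x m) τ := by
  simp only [allLt, allLe, realize_allN, realize_imp, realize_le, realize_lt, eval_var, update_self]
  exact forall_congr' fun m => ⟨fun h h' => h h'.le h', fun h _ => h⟩

@[simp] theorem realize_exLt {x : ℕ} {φ : NTerm → Formula} : (exLt x t φ).Realize M σ τ ↔
    ∃ m, m < t.eval M (update σ x m) τ ∧ (φ (.var x)).Realize M (update σ x m) τ := by
  simp only [exLt, exLe, realize_exN, realize_and, realize_le, realize_lt, eval_var, update_self]
  exact exists_congr fun m => ⟨fun h => h.2, fun h => ⟨h.1.le, h⟩⟩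

@[simp] theorem _root_.BoundedArith.isSigma0_mem2 {X : ℕ} : IsSigma0 (mem2 X s t) ↔ True :=
  isSigma0_mem

end Realize

theorem lt_len {a : M.Num} {S : M.Str} (h : M.mem a S) : a < M.len S :=
  realize_lt.1 (realize_imp.1 (realize_basic (τ := fun _ => S) .l1 a a) h)

/-! ### Comprehension and induction -/

/-- Members of a set lie below its length, so a set of length at most b given by comprehension is
known at all numbers, not just below b. -/
theorem exists_set {φ : Formula} (hφ : IsSigma0 φ) (y : ℕ) (σ : ℕ → M.Num) (τ : ℕ → M.Str)
    (b : M.Num) :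
    ∃ S, M.len S ≤ b ∧ ∀ m, M.mem m S ↔ m < b ∧ φ.Realize M (update σ y m) τ := by
  obtain ⟨S, hS, h⟩ := realize_comprehension hφ y σ τ b
  refine ⟨S, hS, fun m => ⟨fun hm => ?_, fun hm => (h m hm.1.le hm.1.ne).2 hm.2⟩⟩
  have hb := (lt_len hm).trans_le hS
  exact ⟨hb, (h m hb.le hb.ne).1 hm⟩

/-- Ordinary induction for x ≤ y → φ, where the fresh variable y holds b. -/
theorem bounded_induction {φ : Formula} (hφ : IsSigma1 φ) (x : ℕ) (σ : ℕ → M.Num) (τ : ℕ → M.Str)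
    (b : M.Num) (zero : φ.Realize M (update σ x 0) τ)
    (succ : ∀ m < b, φ.Realize M (update σ x m) τ → φ.Realize M (update σ x (m + 1)) τ)
    {m : M.Num} (hm : m ≤ b) : φ.Realize M (update σ x m) τ := by
  obtain ⟨y, hy⟩ := exists_fresh (insert x φ.nfree)
  simp only [Finset.mem_insert, not_or] at hy
  have key (c : M.Num) :
      φ.Realize M (update (update σ y b) x c) τ ↔ φ.Realize M (update σ x c) τ := by
    refine φ.realize_congr (fun z hz => ?_) (fun _ _ => rfl)
    have hzy : z ≠ y := by rintro rfl; exact hy.2 hz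
    by_cases hzx : z = x
    · simp [hzx]
    · simp [hzx, hzy]
  have h := realize_induction (φ := le (.var x) (.var y) ⟹ φ)
    (.or (.of_sigma0 (.neg (.le _ _))) hφ) x (update σ y b) τ
  simp only [realize_imp, realize_le, eval_var, update_self, update_of_ne hy.1, key] at h
  exact h (fun _ => zero) (fun m ih hm => succ m (add_one_le_iff.1 hm)
    (ih (le_self_add.trans hm))) m hm

/-- Induction for `∃ X ≤ c, φ(x, X)`, where `φ(x, X)` expresses `P`. -/
theorem exists_set_induction {φ : Formula} (hφ : IsSigma0 φ) (x X : ℕ) (σ : ℕ → M.Num)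
    (τ : ℕ → M.Str) {P : M.Num → M.Str → Prop}
    (hP : ∀ m S, φ.Realize M (update σ x m) (update τ X S) ↔ P m S) (b c : M.Num)
    (zero : ∃ S, M.len S ≤ c ∧ P 0 S)
    (succ : ∀ m < b, ∀ S, M.len S ≤ c → P m S → ∃ S', M.len S' ≤ c ∧ P (m + 1) S') :
    ∃ S, M.len S ≤ c ∧ P b S := by
  obtain ⟨y, hy⟩ := exists_fresh (insert x φ.nfree)
  simp only [Finset.mem_insert, not_or] at hy
  have key (d : M.Num) (τ) :
      φ.Realize M (update (update σ y c) x d) τ ↔ φ.Realize M (update σ x d) τ := by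
    refine φ.realize_congr (fun z hz => ?_) (fun _ _ => rfl)
    have hzy : z ≠ y := by rintro rfl; exact hy.2 hz
    by_cases hzx : z = x
    · simp [hzx]
    · simp [hzx, hzy]
  -- The length bound c is an element of the model, so it enters the Σ₁ formula as the value of the
  -- fresh variable y.
  have h := bounded_induction (φ := exSLe X (.var y) φ)
    (.exSLe (by simp [NTerm.svars]) (.of_sigma0 hφ)) x (update σ y c) τ b
  simp only [exSLe, realize_exS, realize_and, realize_le, eval_var, eval_len, update_self,
    update_of_ne hy.1, key, hP] at h
  exact h zero (fun m hm ⟨S, hS, h⟩ => succ m hm S hS h) le_rfl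

/-! ### Bounded dependent choice -/

/-- If every element of the invariant `I` at stage `s < S` has a `T`-successor in `I` at stage
`s + 1`, then there is a function `H` on `{0, …, S}` that runs through `I` along `T`. -/
theorem exists_path (I T : M.Str) {S N B u₀ : M.Num}
    (hB : ∀ s ≤ S, ∀ u < N, npair s u < B) (hu₀ : u₀ < N) (hI : M.mem (npair 0 u₀) I)
    (hT : ∀ s < S, ∀ u < N, M.mem (npair s u) I →
      ∃ v < N, M.mem (npair (s + 1) v) I ∧ M.mem (npair s (npair u v)) T) :
    ∃ H, M.len H ≤ B ∧ (∀ w, M.mem w H → ∃ s ≤ S, ∃ u < N, w = npair s u) ∧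
      M.mem (npair 0 u₀) H ∧ (∀ s ≤ S, ∃ u < N, M.mem (npair s u) H) ∧
      (∀ s u u', M.mem (npair s u) H → M.mem (npair s u') H → u = u') ∧
      (∀ w, M.mem w H → M.mem w I) ∧
      (∀ s u v, M.mem (npair s u) H → M.mem (npair (s + 1) v) H →
        M.mem (npair s (npair u v)) T) := by
  -- Induction on z for partial paths H on {0, …, z}. Number variables 0, 1, 2 hold z, N, u₀ and set
  -- variables 0, 1, 2 hold H, I, T; all quantifiers are bounded by z, N or |H|.
  have key := exists_set_induction
    (φ := (allLt 3 (.len 0) fun w => mem w 0 ⟹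
        exLt 4 (.var 0 + 1) fun s => exLt 5 (.var 1) fun u => eqN w (pair s u)) ⋏
      mem2 0 0 (.var 2) ⋏
      (allLt 3 (.var 0 + 1) fun s => exLt 4 (.var 1) fun u => mem2 0 s u) ⋏
      (allLt 3 (.var 0 + 1) fun s => allLt 4 (.var 1) fun u => allLt 5 (.var 1) fun u' =>
        mem2 0 s u ⟹ mem2 0 s u' ⟹ eqN u u') ⋏
      (allLt 3 (.len 0) fun w => mem w 0 ⟹ mem w 1) ⋏
      (allLt 3 (.var 0) fun s => allLt 4 (.var 1) fun u => allLt 5 (.var 1) fun v =>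
        mem2 0 s u ⟹ mem2 0 (s + 1) v ⟹ mem (pair s (pair u v)) 2))
    (by simp) 0 0 (update (fun _ => N) 2 u₀) (update (fun _ => I) 2 T)
    (P := fun z H => (∀ w < M.len H, M.mem w H → ∃ s ≤ z, ∃ u < N, w = npair s u) ∧
      M.mem (npair 0 u₀) H ∧ (∀ s ≤ z, ∃ u < N, M.mem (npair s u) H) ∧
      (∀ s ≤ z, ∀ u < N, ∀ u' < N, M.mem (npair s u) H → M.mem (npair s u') H → u = u') ∧
      (∀ w < M.len H, M.mem w H → M.mem w I) ∧
      (∀ s < z, ∀ u < N, ∀ v < N, M.mem (npair s u) H → M.mem (npair (s + 1) v) H →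
        M.mem (npair s (npair u v)) T))
    (fun z H => by simp [lt_add_one_iff]) S B ?_ ?_
  · obtain ⟨H, hHB, h1, h2, h3, h4, h5, h6⟩ := key
    replace h1 := fun w hw => h1 w (lt_len hw) hw
    have dom {s u : M.Num} (h : M.mem (npair s u) H) : s ≤ S ∧ u < N := by
      obtain ⟨s', hs', u', hu', he⟩ := h1 _ h
      obtain ⟨rfl, rfl⟩ := npair_inj.1 he
      exact ⟨hs', hu'⟩
    exact ⟨H, hHB, h1, h2, h3,
      fun s u u' h h' => h4 s (dom h).1 u (dom h).2 u' (dom h').2 h h',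
      fun w hw => h5 w (lt_len hw) hw,
      fun s u v h h' => h6 s (add_one_le_iff.1 (dom h').1) u (dom h).2 v (dom h').2 h h'⟩
  · obtain ⟨H, hHB, hH⟩ := exists_set (φ := eqN (.var 0) (.var 1)) (by simp) 0
      (fun _ => npair 0 u₀) (fun _ => I) B
    simp at hH
    have hH' (s u : M.Num) : M.mem (npair s u) H ↔ s = 0 ∧ u = u₀ := by
      rw [hH, npair_inj]
      refine ⟨fun h => h.2, ?_⟩
      rintro ⟨rfl, rfl⟩
      exact ⟨hB _ zero_le _ hu₀, rfl, rfl⟩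
    refine ⟨H, hHB, fun w _ hw => ⟨0, le_rfl, u₀, hu₀, ((hH w).1 hw).2⟩, (hH' _ _).2 ⟨rfl, rfl⟩,
      fun s hs => ⟨u₀, hu₀, (hH' _ _).2 ⟨le_antisymm hs zero_le, rfl⟩⟩, ?_, ?_,
      fun s hs => absurd hs zero_le.not_gt⟩
    · intro s _ u _ u' _ h h'
      rw [((hH' _ _).1 h).2, ((hH' _ _).1 h').2]
    · intro w _ hw
      rw [((hH w).1 hw).2]
      exact hI
  · rintro z hz H hHB ⟨h1, h2, h3, h4, h5, h6⟩
    replace h1 := fun w hw => h1 w (lt_len hw) hw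
    have dom {s u : M.Num} (h : M.mem (npair s u) H) : s ≤ z ∧ u < N := by
      obtain ⟨s', hs', u', hu', he⟩ := h1 _ h
      obtain ⟨rfl, rfl⟩ := npair_inj.1 he
      exact ⟨hs', hu'⟩
    obtain ⟨u, hu, hzu⟩ := h3 z le_rfl
    obtain ⟨v, hv, hvI, hvT⟩ := hT z hz u hu (h5 _ (lt_len hzu) hzu)
    -- Extend H by the single pair (z + 1, v): `old` says that earlier stages do not change, `top`
    -- that stage z + 1 has only the value v.
    obtain ⟨H', hHB', hH'⟩ := exists_set (φ := mem (.var 0) 0 ⋎ eqN (.var 0) (.var 1)) (by simp) 0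
      (fun _ => npair (z + 1) v) (fun _ => H) B
    simp at hH'
    have new (w : M.Num) : M.mem w H' ↔ M.mem w H ∨ w = npair (z + 1) v := by
      rw [hH']
      refine ⟨fun h => h.2, fun h => ⟨?_, h⟩⟩
      rcases h with h | rfl
      · exact (lt_len h).trans_le hHB
      · exact hB _ (add_one_le_iff.2 hz) _ hv
    have hlt : z < z + 1 := lt_add_one_iff.2 le_rfl
    have old {s : M.Num} (hs : s ≤ z) (u : M.Num) : M.mem (npair s u) H' ↔ M.mem (npair s u) H := by
      rw [new, npair_inj, or_iff_left]
      rintro ⟨rfl, -⟩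
      exact absurd hs hlt.not_ge
    have top (u : M.Num) : M.mem (npair (z + 1) u) H' ↔ u = v := by
      rw [new, npair_inj, or_iff_right]
      · simp
      · exact fun h => absurd (dom h).1 hlt.not_ge
    have split {s : M.Num} (hs : s ≤ z + 1) : s ≤ z ∨ s = z + 1 :=
      hs.lt_or_eq.imp_left lt_add_one_iff.1
    refine ⟨H', hHB', ?_, (old zero_le _).2 h2, ?_, ?_, ?_, ?_⟩
    · intro w _ hw
      rcases (new w).1 hw with h | rfl
      · obtain ⟨s, hs, u, hu, rfl⟩ := h1 w h
        exact ⟨s, hs.trans hlt.le, u, hu, rfl⟩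
      · exact ⟨_, le_rfl, v, hv, rfl⟩
    · intro s hs
      rcases split hs with hs | rfl
      · obtain ⟨u, hu, h⟩ := h3 s hs
        exact ⟨u, hu, (old hs u).2 h⟩
      · exact ⟨v, hv, (top v).2 rfl⟩
    · intro s hs u hu u' hu' h h'
      rcases split hs with hs | rfl
      · exact h4 s hs u hu u' hu' ((old hs u).1 h) ((old hs u').1 h')
      · rw [(top u).1 h, (top u').1 h']
    · intro w _ hw
      rcases (new w).1 hw with h | rfl
      · exact h5 w (lt_len h) h
      · exact hvI
    · intro s hs u' hu' v' hv' h h'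
      replace hs := lt_add_one_iff.1 hs
      have h := (old hs u').1 h
      rcases hs.lt_or_eq with hs' | rfl
      · exact h6 s hs' u' hu' v' hv' h ((old (add_one_le_iff.2 hs') v').1 h')
      · rw [(top v').1 h', h4 s le_rfl u' hu' u hu h hzu]
        exact hvT

/-! ### Census functions -/

/-- `C` is the graph of the census function of `X`. -/
def IsCensus (X C : M.Str) : Prop :=
  M.len C ≤ npair (M.len X) (M.len X) + 1 ∧ M.mem (npair 0 0) C ∧
  (∀ x < M.len X, ∀ y < M.len C, M.mem (npair x y) C →
    (M.mem x X → M.mem (npair (x + 1) (y + 1)) C) ∧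
    (¬ M.mem x X → M.mem (npair (x + 1) y) C)) ∧
  (∀ x < M.len X + 1, ∀ y < M.len C, ∀ z < M.len C,
    M.mem (npair x y) C ∧ M.mem (npair x z) C → y = z)

theorem realize_isCensus {X C : ℕ} {σ : ℕ → M.Num} {τ : ℕ → M.Str} :
    (isCensus X C).Realize M σ τ ↔ IsCensus (τ X) (τ C) := by
  simp [isCensus, IsCensus]

theorem exists_census (X : M.Str) : ∃ C q, IsCensus X C ∧ M.mem (npair (M.len X) q) C := by
  set L := M.len X with hL
  -- The census is a path through the invariant u ≤ s, which keeps the values at most L; the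
  -- transition set T below increases the value exactly at members of X.
  obtain ⟨I, -, hI⟩ := exists_set
    (φ := exLt 1 (.var 0 + 1) fun s => exLt 2 (s + 1) fun u => eqN (.var 0) (pair s u))
    (by simp) 0 (fun _ => 0) (fun _ => X) (npair L L + 1)
  obtain ⟨T, -, hT⟩ := exists_set
    (φ := exLt 1 (.var 0 + 1) fun s => exLt 2 (.var 0 + 1) fun u => exLt 3 (.var 0 + 1) fun v =>
      eqN (.var 0) (pair s (pair u v)) ⋏
        ((mem s 0 ⋏ eqN v (u + 1)) ⋎ (neg (mem s 0) ⋏ eqN v u)))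
    (by simp) 0 (fun _ => 0) (fun _ => X) (npair L (npair L L) + 1)
  simp [lt_add_one_iff] at hI hT
  have hI' (s u : M.Num) (hs : s ≤ L) : M.mem (npair s u) I ↔ u ≤ s := by
    rw [hI]
    constructor
    · rintro ⟨-, s', -, u', hu', he⟩
      obtain ⟨rfl, rfl⟩ := npair_inj.1 he
      exact hu'
    · intro hu
      exact ⟨npair_le_npair hs (hu.trans hs), s, le_npair_left s u, u, hu, rfl⟩
  have hT' (s u v : M.Num) (hs : s ≤ L) (hu : u ≤ L) (hv : v ≤ L) :
      M.mem (npair s (npair u v)) T ↔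
        (M.mem s X ∧ v = u + 1) ∨ (¬ M.mem s X ∧ v = u) := by
    rw [hT]
    constructor
    · rintro ⟨-, s', -, u', -, v', -, he, h⟩
      simp only [npair_inj] at he
      obtain ⟨rfl, rfl, rfl⟩ := he
      exact h
    · intro h
      exact ⟨npair_le_npair hs (npair_le_npair hu hv), s, le_npair_left _ _, u,
        (le_npair_left _ _).trans (le_npair_right _ _), v,
        (le_npair_right _ _).trans (le_npair_right _ _), rfl, h⟩
  obtain ⟨C, h1, h2, h3, h4, h5, h6, h7⟩ :=
    exists_path I T (S := L) (N := L + 1) (B := npair L L + 1) (u₀ := 0)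
    (fun s hs u hu => lt_add_one_iff.2 (npair_le_npair hs (lt_add_one_iff.1 hu)))
    (lt_add_one_iff.2 zero_le) ((hI' _ _ zero_le).2 le_rfl)
    (by
      intro s hs u hu hsu
      have hus := (hI' s u hs.le).1 hsu
      have hs1 := add_one_le_iff.2 hs
      have huL := hus.trans hs.le
      by_cases hsX : M.mem s X
      · have hu1 : u + 1 ≤ s + 1 := by gcongr
        exact ⟨u + 1, lt_add_one_iff.2 (hu1.trans hs1), (hI' _ _ hs1).2 hu1,
          (hT' _ _ _ hs.le huL (hu1.trans hs1)).2 (.inl ⟨hsX, rfl⟩)⟩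
      · exact ⟨u, hu, (hI' _ _ hs1).2 (hus.trans le_self_add),
          (hT' _ _ _ hs.le huL huL).2 (.inr ⟨hsX, rfl⟩)⟩)
  have dom {s u : M.Num} (h : M.mem (npair s u) C) : s ≤ L ∧ u ≤ L := by
    obtain ⟨s', hs', u', hu', he⟩ := h2 _ h
    obtain ⟨rfl, rfl⟩ := npair_inj.1 he
    exact ⟨hs', lt_add_one_iff.1 hu'⟩
  obtain ⟨q, -, hq⟩ := h4 L le_rfl
  refine ⟨C, q, ⟨h1, h3, fun x hx y hy hxy => ?_, fun x hx y hy z hz h => h5 x y z h.1 h.2⟩, hq⟩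
  obtain ⟨v, hv, hxv⟩ := h4 (x + 1) (add_one_le_iff.2 hx)
  have := (hT' x y v hx.le (dom hxy).2 (lt_add_one_iff.1 hv)).1 (h7 x y v hxy hxv)
  constructor
  · intro hxX
    obtain rfl : v = y + 1 := by simpa [hxX] using this
    exact hxv
  · intro hxX
    obtain rfl : v = y := by simpa [hxX] using this
    exact hxv

/-- Induction on x along the recursion clauses; a value is below the code of its pair, hence below
|C|, which bounds the quantifier. -/
theorem IsCensus.exists_value {X C : M.Str} (h : IsCensus X C) {x : M.Num} (hx : x ≤ M.len X) :
    ∃ y, M.mem (npair x y) C := by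
  have := bounded_induction (φ := exLt 1 (.len 0) fun y => mem2 0 (.var 0) y)
    (.of_sigma0 (by simp)) 0 (fun _ => 0) (fun _ => C) (M.len X)
  simp at this
  obtain ⟨y, -, hy⟩ := this 0 ((le_npair_right _ _).trans_lt (lt_len h.2.1)) h.2.1
    (fun m hm y hy hmy => by
      obtain ⟨h1, h2⟩ := h.2.2.1 m hm y hy hmy
      by_cases hmX : M.mem m X
      · exact ⟨_, (le_npair_right _ _).trans_lt (lt_len (h1 hmX)), h1 hmX⟩
      · exact ⟨_, (le_npair_right _ _).trans_lt (lt_len (h2 hmX)), h2 hmX⟩) hx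
  exact ⟨y, hy⟩

theorem IsCensus.unique {X C : M.Str} (h : IsCensus X C) {x y z : M.Num} (hx : x ≤ M.len X)
    (hy : M.mem (npair x y) C)
    (hz : M.mem (npair x z) C) : y = z :=
  h.2.2.2 x (lt_add_one_iff.2 hx) y ((le_npair_right _ _).trans_lt (lt_len hy)) z
    ((le_npair_right _ _).trans_lt (lt_len hz)) ⟨hy, hz⟩

/-- The census jumps at the member x and never decreases afterwards, by induction on x' - x - 1.
Consequently it is injective on X, with values below q. -/
theorem IsCensus.lt_of_lt {X C : M.Str} (h : IsCensus X C) {x x' y y' : M.Num}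
    (hx : M.mem x X) (hxx' : x < x')
    (hx' : x' ≤ M.len X) (hy : M.mem (npair x y) C) (hy' : M.mem (npair x' y') C) : y < y' := by
  have next {m z : M.Num} (hm : m < M.len X) (hmz : M.mem (npair m z) C) :=
    h.2.2.1 m hm z ((le_npair_right _ _).trans_lt (lt_len hmz)) hmz
  obtain ⟨d, rfl⟩ := exists_eq_add_one_of_lt hxx'
  have := bounded_induction (φ := exLt 1 (.len 0) fun z =>
      lt (.var 3) z ⋏ mem2 0 (.var 2 + .var 0 + 1) z)
    (.of_sigma0 (by simp)) 0 (update (fun _ => x) 3 y) (fun _ => C) d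
  simp at this
  have h0 := (next (lt_len hx) hy).1 hx
  obtain ⟨z, -, hyz, hz⟩ := this (y + 1) ((le_npair_right _ _).trans_lt (lt_len h0))
    (lt_add_one_iff.2 le_rfl) h0
    (fun m hm z _ hyz hmz => by
      have hlt : x + m + 1 < M.len X := by
        refine lt_of_lt_of_le ?_ hx'
        gcongr
      by_cases hmX : M.mem (x + m + 1) X
      · have h' := (next hlt hmz).1 hmX
        rw [add_assoc x m 1] at h'
        exact ⟨_, (le_npair_right _ _).trans_lt (lt_len h'),
          hyz.trans (lt_add_one_iff.2 le_rfl), h'⟩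
      · have h' := (next hlt hmz).2 hmX
        rw [add_assoc x m 1] at h'
        exact ⟨_, (le_npair_right _ _).trans_lt (lt_len h'), hyz, h'⟩) le_rfl
  rwa [h.unique hx' hy' hz]

/-- A strictly decreasing chain of subsets of a set with `q` elements is empty after `q` steps. -/
theorem IsCensus.notMem_of_chain {X C R : M.Str} {q : M.Num} (h : IsCensus X C)
    (hq : M.mem (npair (M.len X) q) C)
    (hanti : ∀ t ≤ q, 1 ≤ t → ∀ e, M.mem e X → M.mem (npair (t + 1) e) R → M.mem (npair t e) R)
    (hstrict : ∀ t ≤ q, 1 ≤ t → ∃ e, M.mem e X ∧ M.mem (npair t e) R ∧ ¬ M.mem (npair (t + 1) e) R)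
    {e : M.Num} (he : M.mem e X) : ¬ M.mem (npair (q + 1) e) R := by
  -- Induction on t: some relation F is total and injective from the part of X in R_{t+1} to the
  -- numbers below q - t, written y + t < q to avoid subtraction. F need not be single-valued. At t
  -- = q no values remain.
  have key := exists_set_induction
    (φ := (allLt 2 (.len 1) fun e => mem e 1 ⟹ mem2 2 (.var 0 + 1) e ⟹
        exLt 3 (.var 1) fun y => lt (y + .var 0) (.var 1) ⋏ mem2 0 e y) ⋏
      (allLt 2 (.len 1) fun e => allLt 3 (.len 1) fun e' => allLt 4 (.var 1) fun y =>
        mem e 1 ⟹ mem e' 1 ⟹ mem2 2 (.var 0 + 1) e ⟹ mem2 2 (.var 0 + 1) e' ⟹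
        mem2 0 e y ⟹ mem2 0 e' y ⟹ eqN e e'))
    (by simp) 0 0 (fun _ => q) (update (fun _ => X) 2 R)
    (P := fun t F => (∀ e < M.len X, M.mem e X → M.mem (npair (t + 1) e) R →
        ∃ y < q, y + t < q ∧ M.mem (npair e y) F) ∧
      (∀ e < M.len X, ∀ e' < M.len X, ∀ y < q, M.mem e X → M.mem e' X →
        M.mem (npair (t + 1) e) R → M.mem (npair (t + 1) e') R →
        M.mem (npair e y) F → M.mem (npair e' y) F → e = e'))
    -- The census starts the induction; the length bound leaves room for C and for all pairs of a
    -- member of X and a number below q.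
    (fun t F => by simp) q (M.len C + npair (M.len X) q) ⟨C, le_self_add, ?_, ?_⟩ ?_
  · intro he'
    obtain ⟨F, -, h1, -⟩ := key
    obtain ⟨y, hyq, hy, -⟩ := h1 e (lt_len he) he he'
    exact absurd hy le_add_self.not_gt
  · intro e _ heX _
    obtain ⟨y, hy⟩ := h.exists_value (lt_len heX).le
    have := h.lt_of_lt heX (lt_len heX) le_rfl hy hq
    exact ⟨y, this, by rwa [add_zero], hy⟩
  · intro e _ e' _ y _ heX heX' _ _ hy hy'
    rcases lt_trichotomy e e' with hlt | heq | hlt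
    · exact absurd (h.lt_of_lt heX hlt (lt_len heX').le hy hy') (lt_irrefl _)
    · exact heq
    · exact absurd (h.lt_of_lt heX' hlt (lt_len heX).le hy' hy) (lt_irrefl _)
  · rintro t ht F hF ⟨htot, hinj⟩
    -- Here m = q - t - 1 is the largest value allowed at stage t, the one to be vacated. The
    -- element e₀ leaves the chain at this stage and frees its value v.
    obtain ⟨m, hm⟩ := exists_eq_add_one_of_lt ht
    obtain ⟨e₀, he₀X, he₀, he₀'⟩ := hstrict (t + 1) (add_one_le_iff.2 ht) le_add_self
    obtain ⟨v, hvq, hvt, hv⟩ := htot e₀ (lt_len he₀X) he₀X he₀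
    have hmq : m < q := by rw [hm]; exact lt_add_one_iff.2 le_add_self
    have lem {y : M.Num} : y + t < q ↔ y ≤ m := by
      rw [hm, lt_add_one_iff, add_comm t m, add_le_add_iff_right]
    have ltm {y : M.Num} : y + (t + 1) < q ↔ y < m := by
      rw [hm, ← add_assoc, add_comm t m, add_lt_add_iff_right, add_lt_add_iff_right]
    have hat := fun e heX => hanti (t + 1) (add_one_le_iff.2 ht) le_add_self e heX
    -- Whatever had the value m also receives v. The old pairs may stay, since totality asks only
    -- for some value below m.
    obtain ⟨F', hF', hmem⟩ := exists_set
      (φ := exLt 1 (.var 0 + 1) fun e => exLt 2 (.var 0 + 1) fun y => eqN (.var 0) (pair e y) ⋏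
        (mem2 0 e y ⋎ (eqN y (.var 4) ⋏ mem2 0 e (.var 3))))
      (by simp) 0 (update (fun _ => m) 4 v) (fun _ => F) (M.len C + npair (M.len X) q)
    simp [lt_add_one_iff] at hmem
    have hmem' {e y : M.Num} (heX : M.mem e X) (hy : y < q) :
        M.mem (npair e y) F' ↔ M.mem (npair e y) F ∨ (y = v ∧ M.mem (npair e m) F) := by
      rw [hmem]
      constructor
      · rintro ⟨-, e', -, y', -, heq, h⟩
        obtain ⟨rfl, rfl⟩ := npair_inj.1 heq
        exact h
      · intro h
        exact ⟨(npair_lt_npair (lt_len heX) hy.le).trans_le le_add_self, e, le_npair_left _ _, y,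
          le_npair_right _ _, rfl, h⟩
    refine ⟨F', hF', fun e _ heX he => ?_, fun e _ e' _ y hy heX heX' he he' hey hey' => ?_⟩
    · obtain ⟨y, hyq, hyt, hy⟩ := htot e (lt_len heX) heX (hat e heX he)
      rcases (lem.1 hyt).lt_or_eq with hlt | rfl
      · exact ⟨y, hyq, ltm.2 hlt, (hmem' heX hyq).2 (.inl hy)⟩
      -- If v were the top value, the surviving e would share it with e₀ and equal e₀ by
      -- injectivity, but e₀ does not survive.
      · have hvm : v ≠ y := by
          rintro rfl
          obtain rfl := hinj e (lt_len heX) e₀ (lt_len he₀X) v hvq heX he₀X (hat e heX he) he₀ hy hv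
          exact he₀' he
        exact ⟨v, hvq, ltm.2 (lt_of_le_of_ne (lem.1 hvt) hvm), (hmem' heX hvq).2 (.inr ⟨rfl, hy⟩)⟩
    · have inj {y : M.Num} (hy : y < q) := hinj e (lt_len heX) e' (lt_len heX') y hy heX heX'
        (hat e heX he) (hat e' heX' he')
      -- No survivor had the old value v, so an old and a new use of v cannot collide.
      have ne {e : M.Num} (heX : M.mem e X) (he : M.mem (npair (t + 1 + 1) e) R) :
          ¬ M.mem (npair e v) F := fun hev => by
        obtain rfl := hinj e (lt_len heX) e₀ (lt_len he₀X) v hvq heX he₀X (hat e heX he) he₀ hev hv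
        exact he₀' he
      rcases (hmem' heX hy).1 hey with h1 | ⟨rfl, h1⟩ <;>
        rcases (hmem' heX' hy).1 hey' with h2 | ⟨h2, h3⟩
      · exact inj hy h1 h2
      · exact absurd (h2 ▸ h1) (ne heX he)
      · exact absurd h2 (ne heX' he')
      · exact inj hmq h1 h3

/-! ### The propagated instance in a model -/

section Realize

variable {σ : ℕ → M.Num} {τ : ℕ → M.Str} {t i j a b : NTerm} {EX V E R : ℕ}

@[simp] theorem _root_.BoundedArith.isSigma0_edge : IsSigma0 (edge E i j a b) ↔ True :=
  isSigma0_mem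

@[simp] theorem _root_.BoundedArith.isSigma0_row : IsSigma0 (row R t i j a b) ↔ True :=
  isSigma0_mem

@[simp] theorem _root_.BoundedArith.isSigma0_edgeR0 : IsSigma0 (edgeR0 EX V E i j a b) ↔ True := by
  simp [edgeR0]

end Realize

/-- The meaning of `isTargetGraph`. -/
def IsTargetGraph (n l : M.Num) (V E : M.Str) : Prop :=
  M.len V ≤ npair n l ∧
  (∀ u < M.len V, M.mem u V → ∃ i < n, ∃ a < l, u = npair i a) ∧
  M.len E ≤ npair (npair n l) (npair n l) ∧
  (∀ w < M.len E, M.mem w E → ∃ i < n, ∃ j < n, ∃ a < l, ∃ b < l,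
    w = npair (npair i a) (npair j b) ∧ M.mem (npair i a) V ∧ M.mem (npair j b) V)

/-- The meaning of `isR1`. -/
def IsR1 (n l : M.Num) (EX V E V₁ E₁ : M.Str) : Prop :=
  IsTargetGraph n l V₁ E₁ ∧
  (∀ i < n, ∀ a < l, M.mem (npair i a) V₁ ↔
    M.mem (npair i a) V ∧
    (∀ j < n, M.mem (npair i j) EX → ∃ b < l, M.mem (npair j b) V ∧ EdgeR0 EX V E i j a b) ∧
    (∀ k < n, M.mem (npair k i) EX → ∃ c < l, M.mem (npair k c) V ∧ EdgeR0 EX V E k i c a)) ∧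
  (∀ i < n, ∀ j < n, ∀ a < l, ∀ b < l,
    Edge E₁ i j a b ↔ M.mem (npair i a) V₁ ∧ M.mem (npair j b) V₁ ∧ EdgeR0 EX V E i j a b)

/-- The meaning of `isPropagation`. -/
def IsPropagation (n l q : M.Num) (V₁ E₁ R : M.Str) : Prop :=
  (∀ i < n, ∀ j < n, ∀ a < l, ∀ b < l, Row R 1 i j a b ↔ Edge E₁ i j a b) ∧
  (∀ t < q + 1, 1 ≤ t → ∀ i < n, ∀ j < n, ∀ a < l, ∀ b < l,
    Row R (t + 1) i j a b ↔ Row R t i j a b ∧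
      ∀ k < n, ∃ c < l, M.mem (npair k c) V₁ ∧ Row R t i k a c ∧ Row R t k j c b)

/-- The meaning of `isAcc`. -/
def IsAcc (n l q : M.Num) (EX V₁ R Vcc Ecc : M.Str) : Prop :=
  IsTargetGraph n l Vcc Ecc ∧
  (∀ i < n, ∀ a < l, M.mem (npair i a) Vcc ↔
    M.mem (npair i a) V₁ ∧
    (∀ j < n, M.mem (npair i j) EX → ∃ b < l, M.mem (npair j b) V₁ ∧ Row R (q + 1) i j a b) ∧
    (∀ k < n, M.mem (npair k i) EX → ∃ c < l, M.mem (npair k c) V₁ ∧ Row R (q + 1) k i c a)) ∧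
  (∀ i < n, ∀ j < n, ∀ a < l, ∀ b < l,
    Edge Ecc i j a b ↔ M.mem (npair i a) Vcc ∧ M.mem (npair j b) Vcc ∧ Row R (q + 1) i j a b)

section Realize

variable {σ : ℕ → M.Num} {τ : ℕ → M.Str} {EX V E V₁ E₁ R Vcc Ecc : ℕ}

theorem realize_isTargetGraph : (isTargetGraph (.var 0) (.var 1) V E).Realize M σ τ ↔
    IsTargetGraph (σ 0) (σ 1) (τ V) (τ E) := by
  simp [isTargetGraph, IsTargetGraph]

theorem realize_isR1 : (isR1 (.var 0) (.var 1) EX V E V₁ E₁).Realize M σ τ ↔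
    IsR1 (σ 0) (σ 1) (τ EX) (τ V) (τ E) (τ V₁) (τ E₁) := by
  simp [isR1, IsR1, realize_isTargetGraph]

theorem realize_isPropagation : (isPropagation (.var 0) (.var 1) (.var 2) V₁ E₁ R).Realize M σ τ ↔
    IsPropagation (σ 0) (σ 1) (σ 2) (τ V₁) (τ E₁) (τ R) := by
  simp [isPropagation, IsPropagation]

theorem realize_isAcc : (isAcc (.var 0) (.var 1) (.var 2) EX V₁ R Vcc Ecc).Realize M σ τ ↔
    IsAcc (σ 0) (σ 1) (σ 2) (τ EX) (τ V₁) (τ R) (τ Vcc) (τ Ecc) := by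
  simp [isAcc, IsAcc, realize_isTargetGraph]

theorem _root_.BoundedArith.isSigma0_isPropagation :
    IsSigma0 (isPropagation (.var 0) (.var 1) (.var 2) V₁ E₁ R) := by
  simp [isPropagation]

end Realize

/-! ### Existence of the propagated instance -/

/-- Variables 0 and 1 carry n and l, variable 10 the code under test, and 3 and 4 its components,
matching the names used in the definitions. -/
theorem exists_domains {φ : Formula} (hφ : IsSigma0 φ) (σ : ℕ → M.Num) (τ : ℕ → M.Str)
    {P : M.Num → M.Num → Prop}
    (hP : ∀ u i a, φ.Realize M (update (update (update σ 10 u) 3 i) 4 a) τ ↔ P i a) :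
    ∃ V, M.len V ≤ npair (σ 0) (σ 1) ∧
      ∀ u, M.mem u V ↔ ∃ i < σ 0, ∃ a < σ 1, u = npair i a ∧ P i a := by
  obtain ⟨V, hV, h⟩ := exists_set
    (φ := exLt 3 (.var 0) fun i => exLt 4 (.var 1) fun a => eqN (.var 10) (pair i a) ⋏ φ)
    (by simp [hφ]) 10 σ τ (npair (σ 0) (σ 1))
  simp [hP] at h
  refine ⟨V, hV, fun u => (h u).trans ⟨fun h => h.2, fun h => ⟨?_, h⟩⟩⟩
  obtain ⟨i, hi, a, ha, rfl, -⟩ := h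
  exact npair_lt_npair hi ha.le

theorem exists_relations {φ : Formula} (hφ : IsSigma0 φ) (σ : ℕ → M.Num) (τ : ℕ → M.Str)
    {P : M.Num → M.Num → M.Num → M.Num → Prop}
    (hP : ∀ w i j a b, φ.Realize M
      (update (update (update (update (update σ 10 w) 3 i) 4 j) 5 a) 6 b) τ ↔ P i j a b) :
    ∃ E, M.len E ≤ npair (npair (σ 0) (σ 1)) (npair (σ 0) (σ 1)) ∧
      ∀ w, M.mem w E ↔ ∃ i < σ 0, ∃ j < σ 0, ∃ a < σ 1, ∃ b < σ 1,
        w = npair (npair i a) (npair j b) ∧ P i j a b := by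
  obtain ⟨E, hE, h⟩ := exists_set
    (φ := exLt 3 (.var 0) fun i => exLt 4 (.var 0) fun j => exLt 5 (.var 1) fun a =>
      exLt 6 (.var 1) fun b => eqN (.var 10) (pair (pair i a) (pair j b)) ⋏ φ)
    (by simp [hφ]) 10 σ τ (npair (npair (σ 0) (σ 1)) (npair (σ 0) (σ 1)))
  simp [hP] at h
  refine ⟨E, hE, fun u => (h u).trans ⟨fun h => h.2, fun h => ⟨?_, h⟩⟩⟩
  obtain ⟨i, hi, j, hj, a, ha, b, hb, rfl, -⟩ := h
  exact npair_lt_npair (npair_lt_npair hi ha.le) (npair_lt_npair hj hb.le).le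

/-- A target digraph is determined by `Σ₀^{1,b}`-definitions of its domains and of its relations in
terms of the domains. -/
theorem exists_targetGraph {φ ψ : Formula} (hφ : IsSigma0 φ) (hψ : IsSigma0 ψ) (σ : ℕ → M.Num)
    (τ : ℕ → M.Str) {P : M.Num → M.Num → Prop} {Q : M.Num → M.Num → M.Num → M.Num → Prop}
    (hP : ∀ u i a, φ.Realize M (update (update (update σ 10 u) 3 i) 4 a) τ ↔ P i a)
    (hQ : ∀ w i j a b, ψ.Realize M
      (update (update (update (update (update σ 10 w) 3 i) 4 j) 5 a) 6 b) τ ↔ Q i j a b) :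
    ∃ V E, IsTargetGraph (σ 0) (σ 1) V E ∧
      (∀ i < σ 0, ∀ a < σ 1, M.mem (npair i a) V ↔ P i a) ∧
      (∀ i < σ 0, ∀ j < σ 0, ∀ a < σ 1, ∀ b < σ 1,
        Edge E i j a b ↔ M.mem (npair i a) V ∧ M.mem (npair j b) V ∧ Q i j a b) := by
  obtain ⟨V, hV, h⟩ := exists_domains hφ σ τ hP
  -- The domain just built becomes a parameter in a set variable foreign to ψ, so the meaning of ψ
  -- is unaffected.
  obtain ⟨X, hX⟩ := exists_fresh ψ.sfree
  obtain ⟨E, hE, h'⟩ := exists_relations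
    (φ := mem2 X (.var 3) (.var 5) ⋏ mem2 X (.var 4) (.var 6) ⋏ ψ) (by simp [hψ]) σ
    (update τ X V)
    (P := fun i j a b => M.mem (npair i a) V ∧ M.mem (npair j b) V ∧ Q i j a b)
    (fun w i j a b => by
      have : ψ.Realize M (update (update (update (update (update σ 10 w) 3 i) 4 j) 5 a) 6 b)
          (update τ X V) ↔ Q i j a b := by
        rw [← hQ w]
        refine ψ.realize_congr (fun _ _ => rfl) fun Y hY => update_of_ne ?_ _ _
        rintro rfl
        exact hX hY
      simp [this])
  refine ⟨V, E, ⟨hV, fun u _ hu => ?_, hE, fun w _ hw => ?_⟩, fun i hi a ha => ?_,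
    fun i hi j hj a ha b hb => ?_⟩
  · obtain ⟨i, hi, a, ha, hu, -⟩ := (h u).1 hu
    exact ⟨i, hi, a, ha, hu⟩
  · obtain ⟨i, hi, j, hj, a, ha, b, hb, hw, h1, h2, -⟩ := (h' w).1 hw
    exact ⟨i, hi, j, hj, a, ha, b, hb, hw, h1, h2⟩
  · rw [h]
    constructor
    · rintro ⟨i', -, a', -, he, hp⟩
      obtain ⟨rfl, rfl⟩ := npair_inj.1 he
      exact hp
    · exact fun hp => ⟨i, hi, a, ha, rfl, hp⟩
  · rw [Edge, h']
    constructor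
    · rintro ⟨i', -, j', -, a', -, b', -, he, hp⟩
      simp only [npair_inj] at he
      obtain ⟨⟨rfl, rfl⟩, rfl, rfl⟩ := he
      exact hp
    · exact fun hp => ⟨i, hi, j, hj, a, ha, b, hb, rfl, hp⟩

theorem exists_isR1 (n l : M.Num) (EX V E : M.Str) : ∃ V₁ E₁, IsR1 n l EX V E V₁ E₁ :=
  exists_targetGraph
    (φ := mem2 1 (.var 3) (.var 4) ⋏
      (allLt 5 (.var 0) fun j => mem2 0 (.var 3) j ⟹
        exLt 6 (.var 1) fun b => mem2 1 j b ⋏ edgeR0 0 1 2 (.var 3) j (.var 4) b) ⋏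
      (allLt 5 (.var 0) fun k => mem2 0 k (.var 3) ⟹
        exLt 6 (.var 1) fun c => mem2 1 k c ⋏ edgeR0 0 1 2 k (.var 3) c (.var 4)))
    (ψ := edgeR0 0 1 2 (.var 3) (.var 4) (.var 5) (.var 6)) (by simp) (by simp)
    (update (fun _ => l) 0 n) (update (update (fun _ => E) 1 V) 0 EX)
    (fun u i a => by simp) (fun w i j a b => by simp)

theorem exists_isAcc (n l q : M.Num) (EX V₁ R : M.Str) :
    ∃ Vcc Ecc, IsAcc n l q EX V₁ R Vcc Ecc :=
  exists_targetGraph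
    (φ := mem2 1 (.var 3) (.var 4) ⋏
      (allLt 5 (.var 0) fun j => mem2 0 (.var 3) j ⟹
        exLt 6 (.var 1) fun b => mem2 1 j b ⋏ row 2 (.var 2 + 1) (.var 3) j (.var 4) b) ⋏
      (allLt 5 (.var 0) fun k => mem2 0 k (.var 3) ⟹
        exLt 6 (.var 1) fun c => mem2 1 k c ⋏ row 2 (.var 2 + 1) k (.var 3) c (.var 4)))
    (ψ := row 2 (.var 2 + 1) (.var 3) (.var 4) (.var 5) (.var 6)) (by simp) (by simp)
    (update (update (fun _ => l) 2 q) 0 n) (update (update (fun _ => R) 1 V₁) 0 EX)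
    (fun u i a => by simp) (fun w i j a b => by simp)

theorem exists_isPropagation (n l q : M.Num) (V₁ E₁ : M.Str) :
    ∃ R, IsPropagation n l q V₁ E₁ R := by
  -- The induction variable is the one in the place of q: stage z has rows 1, …, z + 1. Up to z = q
  -- all row indices stay below q + 2, whence the length bound.
  have key := exists_set_induction (isSigma0_isPropagation (V₁ := 1) (E₁ := 2) (R := 0)) 2 0
    (update (fun _ => l) 0 n) (update (fun _ => V₁) 2 E₁)
    (P := fun z R => IsPropagation n l z V₁ E₁ R)
    (fun z R => by simp [realize_isPropagation]) q
    (npair (q + 2) (npair (npair n l) (npair n l))) ?_ ?_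
  · obtain ⟨R, -, hR⟩ := key
    exact ⟨R, hR⟩
  · obtain ⟨R, hR, h⟩ := exists_set
      (φ := exLt 1 (.var 0 + 1) fun e => mem e 0 ⋏ eqN (.var 0) (pair 1 e)) (by simp) 0
      (fun _ => 0) (fun _ => E₁) (npair (q + 2) (npair (npair n l) (npair n l)))
    simp [lt_add_one_iff] at h
    refine ⟨R, hR, fun i hi j hj a ha b hb => ?_, fun t ht ht' => ?_⟩
    · rw [Row, h, Edge]
      constructor
      · rintro ⟨-, e, -, he, heq⟩
        obtain ⟨-, rfl⟩ := npair_inj.1 heq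
        exact he
      · intro he
        refine ⟨npair_lt_npair ?_ ?_, _, le_npair_right _ _, he, rfl⟩
        · rw [← one_add_one_eq_two, ← add_assoc]
          exact lt_add_one_iff.2 le_add_self
        · exact npair_le_npair (npair_le_npair hi.le ha.le) (npair_le_npair hj.le hb.le)
    · exact absurd ht' (by simpa using ht)
  · intro z hz R hR h
    -- Keep the rows up to z + 1 and define row z + 2 from row z + 1 by the propagation step.
    obtain ⟨R', hR', h'⟩ := exists_set
      (φ := exLt 9 (.var 2 + 1 + 1 + 1) fun t => exLt 3 (.var 0) fun i => exLt 4 (.var 0) fun j =>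
        exLt 5 (.var 1) fun a => exLt 6 (.var 1) fun b =>
          eqN (.var 10) (pair t (pair (pair i a) (pair j b))) ⋏
          ((lt t (.var 2 + 1 + 1) ⋏ row 0 t i j a b) ⋎
            (eqN t (.var 2 + 1 + 1) ⋏ row 0 (.var 2 + 1) i j a b ⋏
              allLt 7 (.var 0) fun k => exLt 8 (.var 1) fun c =>
                mem2 1 k c ⋏ row 0 (.var 2 + 1) i k a c ⋏ row 0 (.var 2 + 1) k j c b)))
      (by simp) 10 (update (update (fun _ => l) 0 n) 2 z) (update (fun _ => R) 1 V₁)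
      (npair (q + 2) (npair (npair n l) (npair n l)))
    simp [lt_add_one_iff] at h'
    have hz2 : z + 1 + 1 < q + 2 := by
      rw [← one_add_one_eq_two, ← add_assoc]
      gcongr
    have hrow (t : M.Num) {i j a b : M.Num} (hi : i < n) (hj : j < n) (ha : a < l) (hb : b < l) :
        Row R' t i j a b ↔ (t ≤ z + 1 ∧ Row R t i j a b) ∨
          (t = z + 1 + 1 ∧ Row R (z + 1) i j a b ∧ ∀ k < n, ∃ c < l,
            M.mem (npair k c) V₁ ∧ Row R (z + 1) i k a c ∧ Row R (z + 1) k j c b) := by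
      rw [Row, h']
      constructor
      · rintro ⟨-, t', -, i', -, j', -, a', -, b', -, he, h⟩
        simp only [npair_inj] at he
        obtain ⟨rfl, ⟨rfl, rfl⟩, rfl, rfl⟩ := he
        exact h
      · intro h
        have ht : t ≤ z + 1 + 1 := by
          rcases h with h | h
          · exact h.1.trans le_self_add
          · exact h.1.le
        exact ⟨npair_lt_npair (ht.trans_lt hz2)
          (npair_le_npair (npair_le_npair hi.le ha.le) (npair_le_npair hj.le hb.le)),
          t, ht, i, hi, j, hj, a, ha, b, hb, rfl, h⟩
    have old {t : M.Num} (ht : t ≤ z + 1) {i j a b : M.Num} (hi : i < n) (hj : j < n) (ha : a < l)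
        (hb : b < l) : Row R' t i j a b ↔ Row R t i j a b := by
      rw [hrow t hi hj ha hb, or_iff_left, and_iff_right ht]
      rintro ⟨rfl, -⟩
      exact absurd ht (lt_add_one_iff.2 le_rfl).not_ge
    refine ⟨R', hR', fun i hi j hj a ha b hb => ?_, fun t ht ht1 i hi j hj a ha b hb => ?_⟩
    · rw [old le_add_self hi hj ha hb, h.1 i hi j hj a ha b hb]
    · rw [lt_add_one_iff] at ht
      have hR (k : M.Num) (hk : k < n) : (∃ c < l, M.mem (npair k c) V₁ ∧ Row R' t i k a c ∧
          Row R' t k j c b) ↔ ∃ c < l, M.mem (npair k c) V₁ ∧ Row R t i k a c ∧ Row R t k j c b :=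
        exists_congr fun c => and_congr_right fun hc => by
          rw [old ht hi hk ha hc, old ht hk hj hc hb]
      rw [old ht hi hj ha hb, forall₂_congr hR]
      rcases ht.lt_or_eq with ht' | rfl
      · rw [old (add_one_le_iff.2 ht') hi hj ha hb]
        exact h.2 t ht' ht1 i hi j hj a ha b hb
      · rw [hrow _ hi hj ha hb, or_iff_right, and_iff_right rfl]
        exact fun h => absurd h.1 (lt_add_one_iff.2 le_rfl).not_ge

/-! ### Stability of the propagation -/

section Propagation

variable {n l q : M.Num} {EX V E V₁ E₁ C R Vcc Ecc : M.Str}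

/-- The rows decrease from R_1, which is E₁. They are numbered from 1 while induction starts at 0,
hence the index z + 1. -/
theorem IsPropagation.edge_of_row (h : IsPropagation n l q V₁ E₁ R) {z : M.Num} (hz : z ≤ q)
    {i j a b : M.Num} (hi : i < n) (hj : j < n) (ha : a < l) (hb : b < l)
    (hr : Row R (z + 1) i j a b) : Edge E₁ i j a b := by
  have key := bounded_induction
    (φ := row 0 (.var 0 + 1) (.var 1) (.var 2) (.var 3) (.var 4) ⟹
      edge 1 (.var 1) (.var 2) (.var 3) (.var 4)) (.of_sigma0 (by simp)) 0
    (update (update (update (fun _ => i) 2 j) 3 a) 4 b) (update (fun _ => R) 1 E₁) q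
  simp at key
  exact key (h.1 i hi j hj a ha b hb).1
    (fun m hm ih hr => ih ((h.2 (m + 1) (by gcongr) le_add_self i hi j hj a ha b hb).1 hr).1) hz hr

/-- Exchanging (i,a) and (j,b) merely swaps the two conditions on the witness c. The induction
formula quantifies over all i, j, a, b because the step uses symmetry at (i,k) and (k,j). -/
theorem IsPropagation.row_symm (h : IsPropagation n l q V₁ E₁ R)
    (hE₁ : ∀ i < n, ∀ j < n, ∀ a < l, ∀ b < l, Edge E₁ i j a b → Edge E₁ j i b a) {z : M.Num}
    (hz : z ≤ q) {i j a b : M.Num} (hi : i < n) (hj : j < n) (ha : a < l) (hb : b < l)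
    (hr : Row R (z + 1) i j a b) : Row R (z + 1) j i b a := by
  have key := bounded_induction
    (φ := allLt 3 (.var 1) fun i => allLt 4 (.var 1) fun j => allLt 5 (.var 2) fun a =>
      allLt 6 (.var 2) fun b => row 0 (.var 0 + 1) i j a b ⟹ row 0 (.var 0 + 1) j i b a)
    (.of_sigma0 (by simp)) 0 (update (fun _ => l) 1 n) (fun _ => R) q
  simp at key
  refine key ?_ ?_ hz i hi j hj a ha b hb hr
  · intro i hi j hj a ha b hb hr
    rw [h.1 i hi j hj a ha b hb] at hr
    rw [h.1 j hj i hi b hb a ha]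
    exact hE₁ i hi j hj a ha b hb hr
  · intro m hm ih i hi j hj a ha b hb hr
    have hm1 : m + 1 < q + 1 := by gcongr
    rw [h.2 (m + 1) hm1 le_add_self i hi j hj a ha b hb] at hr
    rw [h.2 (m + 1) hm1 le_add_self j hj i hi b hb a ha]
    refine ⟨ih i hi j hj a ha b hb hr.1, fun k hk => ?_⟩
    obtain ⟨c, hc, hV, h1, h2⟩ := hr.2 k hk
    exact ⟨c, hc, hV, ih k hk j hj c hc b hb h2, ih i hi k hk a ha c hc h1⟩

/-- Once two successive relations agree, the propagation has stabilized. -/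
theorem IsPropagation.stable (h : IsPropagation n l q V₁ E₁ R) {t : M.Num} (ht1 : 1 ≤ t)
    (ht : t ≤ q)
    (hst : ∀ i < n, ∀ j < n, ∀ a < l, ∀ b < l, Row R t i j a b → Row R (t + 1) i j a b) :
    ∀ i < n, ∀ j < n, ∀ a < l, ∀ b < l, Row R q i j a b → Row R (q + 1) i j a b := by
  obtain ⟨d, rfl⟩ := num_le_iff.1 ht
  have key := bounded_induction
    (φ := allLt 3 (.var 1) fun i => allLt 4 (.var 1) fun j => allLt 5 (.var 2) fun a =>
      allLt 6 (.var 2) fun b => row 0 (.var 7 + .var 0) i j a b ⟹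
        row 0 (.var 7 + .var 0 + 1) i j a b)
    (.of_sigma0 (by simp)) 0 (update (update (fun _ => l) 1 n) 7 t) (fun _ => R) d
  simp at key
  refine key hst ?_ le_rfl
  intro m hm ih i hi j hj a ha b hb hr
  rw [← add_assoc] at hr ⊢
  have hlt : t + m < t + d + 1 := lt_add_one_iff.2 (by gcongr)
  have hlt' : t + m + 1 < t + d + 1 := by gcongr
  refine (h.2 (t + m + 1) hlt' le_add_self i hi j hj a ha b hb).2 ⟨hr, fun k hk => ?_⟩
  -- The witness that put the tuple into R_{t+m+1} lives in R_{t+m}; the induction hypothesis lifts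
  -- its two pairs one row higher.
  obtain ⟨c, hc, hV, h1, h2⟩ :=
    ((h.2 (t + m) hlt (ht1.trans le_self_add) i hi j hj a ha b hb).1 hr).2 k hk
  exact ⟨c, hc, hV, ih i hi k hk a ha c hc h1, ih k hk j hj c hc b hb h2⟩

/-- `R_{q+1}` is closed under the propagation step: either the propagation stabilizes before, or
`R_{q+1}` is empty. -/
theorem IsPropagation.closed (h : IsPropagation n l q V₁ E₁ R) (hT : IsTargetGraph n l V₁ E₁)
    (hC : IsCensus E₁ C) (hq : M.mem (npair (M.len E₁) q) C) {i j a b : M.Num} (hi : i < n)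
    (hj : j < n) (ha : a < l) (hb : b < l) (hr : Row R (q + 1) i j a b) {k : M.Num} (hk : k < n) :
    ∃ c < l, M.mem (npair k c) V₁ ∧ Row R (q + 1) i k a c ∧ Row R (q + 1) k j c b := by
  -- Only codes in E₁ are compared, as the rows may contain junk outside the relevant range.
  by_cases hst : ∃ t, 1 ≤ t ∧ t ≤ q ∧ ∀ e, M.mem e E₁ → M.mem (npair t e) R →
      M.mem (npair (t + 1) e) R
  · obtain ⟨t, ht1, ht, hst⟩ := hst
    have hstab := h.stable ht1 ht fun i hi j hj a ha b hb hr => by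
      refine hst _ ?_ hr
      obtain ⟨d, rfl⟩ := num_le_iff.1 ht1
      rw [add_comm] at hr ht
      exact h.edge_of_row (le_self_add.trans ht) hi hj ha hb hr
    -- Membership in R_{q+1} gives a witness in R_q, and R_q ⊆ R_{q+1} on the relevant tuples by
    -- stabilization.
    obtain ⟨c, hc, hV, h1, h2⟩ :=
      ((h.2 q (lt_add_one_iff.2 le_rfl) (ht1.trans ht) i hi j hj a ha b hb).1 hr).2 k hk
    exact ⟨c, hc, hV, hstab i hi k hk a ha c hc h1, hstab k hk j hj c hc b hb h2⟩
  · push Not at hst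
    refine absurd hr (hC.notMem_of_chain hq (fun t ht ht1 e he hr => ?_)
      (fun t ht ht1 => hst t ht1 ht) (h.edge_of_row le_rfl hi hj ha hb hr))
    obtain ⟨i, hi, j, hj, a, ha, b, hb, rfl, -⟩ := hT.2.2.2 e (lt_len he) he
    exact ((h.2 t (lt_add_one_iff.2 ht) ht1 i hi j hj a ha b hb).1 hr).1

end Propagation

/-! ### Cycle-consistency -/

/-- The properties of a target digraph from which cycle-consistency follows. -/
structure Saturated (n l : M.Num) (EX V E : M.Str) : Prop where
  dom : ∀ u u', M.mem (npair u u') E → M.mem u V ∧ M.mem u' V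
  symm : ∀ u u', M.mem (npair u u') E → M.mem (npair u' u) E
  extend : ∀ i < n, ∀ a < l, M.mem (npair i a) V → ∀ j < n,
    M.mem (npair i j) EX ∨ M.mem (npair j i) EX → ∃ b < l, Edge E i j a b
  closed : ∀ i < n, ∀ j < n, ∀ a < l, ∀ b < l, Edge E i j a b → ∀ k < n,
    ∃ c < l, Edge E i k a c ∧ Edge E k j c b

/-- Closure of R_{q+1} puts both ends of each of its pairs into the new domains, so restricting to
these domains loses nothing. E_cc thus agrees with R_{q+1} and inherits symmetry and closure. -/
theorem IsAcc.saturated {n l q : M.Num} {EX V E V₁ E₁ C R Vcc Ecc : M.Str}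
    (h₁ : IsR1 n l EX V E V₁ E₁) (hC : IsCensus E₁ C) (hq : M.mem (npair (M.len E₁) q) C)
    (hR : IsPropagation n l q V₁ E₁ R) (h : IsAcc n l q EX V₁ R Vcc Ecc) :
    Saturated n l EX Vcc Ecc := by
  have symm₁ : ∀ i < n, ∀ j < n, ∀ a < l, ∀ b < l, Edge E₁ i j a b → Edge E₁ j i b a := by
    intro i hi j hj a ha b hb he
    rw [h₁.2.2 i hi j hj a ha b hb] at he
    rw [h₁.2.2 j hj i hi b hb a ha]
    exact ⟨he.2.1, he.1, he.2.2.symm⟩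
  have symm {i j a b : M.Num} (hi : i < n) (hj : j < n) (ha : a < l) (hb : b < l)
      (hr : Row R (q + 1) i j a b) : Row R (q + 1) j i b a :=
    hR.row_symm symm₁ le_rfl hi hj ha hb hr
  -- One R_{q+1}-pair at (i,a) suffices: closure yields a partner of (i,a) at every index k, and
  -- symmetry handles incoming edges.
  have dom {i j a b : M.Num} (hi : i < n) (hj : j < n) (ha : a < l) (hb : b < l)
      (hr : Row R (q + 1) i j a b) : M.mem (npair i a) Vcc := by
    have he := (h₁.2.2 i hi j hj a ha b hb).1 (hR.edge_of_row le_rfl hi hj ha hb hr)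
    refine (h.2.1 i hi a ha).2 ⟨he.1, fun k hk _ => ?_, fun k hk _ => ?_⟩
    · obtain ⟨c, hc, hV, h1, -⟩ := hR.closed h₁.1 hC hq hi hj ha hb hr hk
      exact ⟨c, hc, hV, h1⟩
    · obtain ⟨c, hc, hV, h1, -⟩ := hR.closed h₁.1 hC hq hi hj ha hb hr hk
      exact ⟨c, hc, hV, symm hi hk ha hc h1⟩
  have edge {i j a b : M.Num} (hi : i < n) (hj : j < n) (ha : a < l) (hb : b < l) :
      Edge Ecc i j a b ↔ Row R (q + 1) i j a b := by
    rw [h.2.2 i hi j hj a ha b hb]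
    exact ⟨fun h => h.2.2, fun hr =>
      ⟨dom hi hj ha hb hr, dom hj hi hb ha (symm hi hj ha hb hr), hr⟩⟩
  constructor
  · intro u u' hu
    obtain ⟨i, hi, j, hj, a, ha, b, hb, he, h1, h2⟩ := h.1.2.2.2 _ (lt_len hu) hu
    obtain ⟨rfl, rfl⟩ := npair_inj.1 he
    exact ⟨h1, h2⟩
  · intro u u' hu
    obtain ⟨i, hi, j, hj, a, ha, b, hb, he, -⟩ := h.1.2.2.2 _ (lt_len hu) hu
    obtain ⟨rfl, rfl⟩ := npair_inj.1 he
    exact (edge hj hi hb ha).2 (symm hi hj ha hb ((edge hi hj ha hb).1 hu))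
  · intro i hi a ha hV j hj hEX
    obtain ⟨-, h1, h2⟩ := (h.2.1 i hi a ha).1 hV
    rcases hEX with hEX | hEX
    · obtain ⟨b, hb, -, hr⟩ := h1 j hj hEX
      exact ⟨b, hb, (edge hi hj ha hb).2 hr⟩
    · obtain ⟨b, hb, -, hr⟩ := h2 j hj hEX
      exact ⟨b, hb, (edge hi hj ha hb).2 (symm hj hi hb ha hr)⟩
  · intro i hi j hj a ha b hb he k hk
    obtain ⟨c, hc, -, h1, h2⟩ := hR.closed h₁.1 hC hq hi hj ha hb ((edge hi hj ha hb).1 he) hk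
    exact ⟨c, hc, (edge hi hk ha hc).2 h1, (edge hk hj hc hb).2 h2⟩

/-- The meaning of `oneConsistent`. -/
def OneConsistent (n l : M.Num) (EX V E : M.Str) : Prop :=
  ∀ i < n, ∀ a < l, M.mem (npair i a) V → ∀ j < n,
    (M.mem (npair i j) EX → ∃ b < l, M.mem (npair j b) V ∧ Edge E i j a b) ∧
    (M.mem (npair j i) EX → ∃ b < l, M.mem (npair j b) V ∧ Edge E j i b a)

/-- The meaning of `isCycle`. -/
def IsCycle (t : M.Num) (EC : M.Str) : Prop :=
  1 + 1 ≤ t ∧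
  (∀ s < t, s + 1 = t → M.mem (npair 0 s) EC ∨ M.mem (npair s 0) EC) ∧
  (∀ i < t, i + 1 < t → M.mem (npair i (i + 1)) EC ∨ M.mem (npair (i + 1) i) EC) ∧
  (∀ i < t, ∀ j < t, M.mem (npair i j) EC →
    j = i + 1 ∨ i = j + 1 ∨ (i = 0 ∧ j + 1 = t) ∨ (j = 0 ∧ i + 1 = t))

/-- The meaning of `isHomInput`. -/
def IsHomInput (t n : M.Num) (EC EX H : M.Str) : Prop :=
  (∀ i < t, ∃ j < n, M.mem (npair i j) H) ∧
  (∀ i < t, ∀ j < n, ∀ j' < n, M.mem (npair i j) H ∧ M.mem (npair i j') H → j = j') ∧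
  (∀ i < t, ∀ i' < t, ∀ j < n, ∀ j' < n,
    M.mem (npair i i') EC ∧ M.mem (npair i j) H ∧ M.mem (npair i' j') H → M.mem (npair j j') EX)

/-- The meaning of `isHomTarget`. -/
def IsHomTarget (t n l : M.Num) (EC V E H' : M.Str) : Prop :=
  (∀ i < t, ∃ u < npair n l, M.mem u V ∧ M.mem (npair i u) H') ∧
  (∀ i < t, ∀ u < npair n l, ∀ u' < npair n l,
    M.mem (npair i u) H' ∧ M.mem (npair i u') H' → u = u') ∧
  (∀ i < t, ∀ i' < t, ∀ u < npair n l, ∀ u' < npair n l,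
    M.mem (npair i i') EC ∧ M.mem (npair i u) H' ∧ M.mem (npair i' u') H' → M.mem (npair u u') E)

/-- The meaning of `cycleConsistent`. -/
def CycleConsistent (n l : M.Num) (EX V E : M.Str) : Prop :=
  OneConsistent n l EX V E ∧
  ∀ k < n, ∀ a < l, M.mem (npair k a) V → ∀ t EC H,
    IsCycle t EC ∧ IsHomInput t n EC EX H ∧ M.mem (npair 0 k) H →
    ∃ H', M.len H' ≤ npair t (npair n l) ∧ IsHomTarget t n l EC V E H' ∧
      (∀ i < n, ∀ j < t, M.mem (npair j i) H →
        ∃ b < l, M.mem (npair i b) V ∧ M.mem (npair j (npair i b)) H') ∧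
      M.mem (npair 0 (npair k a)) H'

section Realize

variable {σ : ℕ → M.Num} {τ : ℕ → M.Str} {EX V E EC H H' : ℕ}

theorem realize_oneConsistent : (oneConsistent (.var 0) (.var 1) EX V E).Realize M σ τ ↔
    OneConsistent (σ 0) (σ 1) (τ EX) (τ V) (τ E) := by
  simp [oneConsistent, OneConsistent]

theorem realize_isCycle :
    (isCycle (.var 5) EC).Realize M σ τ ↔ IsCycle (σ 5) (τ EC) := by
  simp [isCycle, IsCycle]

theorem realize_isHomInput : (isHomInput (.var 5) (.var 0) EC EX H).Realize M σ τ ↔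
    IsHomInput (σ 5) (σ 0) (τ EC) (τ EX) (τ H) := by
  simp [isHomInput, IsHomInput]

theorem realize_isHomTarget : (isHomTarget (.var 5) (.var 0) (.var 1) EC V E H').Realize M σ τ ↔
    IsHomTarget (σ 5) (σ 0) (σ 1) (τ EC) (τ V) (τ E) (τ H') := by
  simp [isHomTarget, IsHomTarget]

theorem realize_cycleConsistent :
    (cycleConsistent (.var 0) (.var 1) 0 7 8 9 10 11).Realize M σ τ ↔
      CycleConsistent (σ 0) (σ 1) (τ 0) (τ 7) (τ 8) := by
  simp [cycleConsistent, CycleConsistent, exSLe, realize_allN, realize_allS, realize_exS,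
    realize_oneConsistent, realize_isCycle, realize_isHomInput, realize_isHomTarget]

end Realize

theorem Saturated.oneConsistent {n l : M.Num} {EX V E : M.Str} (h : Saturated n l EX V E) :
    OneConsistent n l EX V E := by
  intro i hi a ha hV j hj
  constructor <;> intro hEX
  · obtain ⟨b, hb, he⟩ := h.extend i hi a ha hV j hj (.inl hEX)
    exact ⟨b, hb, (h.dom _ _ he).2, he⟩
  · obtain ⟨b, hb, he⟩ := h.extend i hi a ha hV j hj (.inr hEX)
    exact ⟨b, hb, (h.dom _ _ he).2, h.symm _ _ he⟩

/-- Walk along the cycle while staying adjacent to the start (k,a). `extend` gives the first step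
and `closed` all later ones; symmetry makes the orientation of the cycle's edges irrelevant. -/
theorem Saturated.cycleConsistent {n l : M.Num} {EX V E : M.Str} (h : Saturated n l EX V E) :
    CycleConsistent n l EX V E := by
  refine ⟨h.oneConsistent, fun k hk a ha hka t EC H ⟨hC, hH, hHk⟩ => ?_⟩
  -- The length is 1 + c + 1 and the last vertex 1 + c is nonzero, so the invariant there is
  -- adjacency to (k,a).
  obtain ⟨c, rfl⟩ := exists_eq_add_one_of_lt (add_one_le_iff.1 hC.1)
  have hlt {s : M.Num} : s < 1 + c + 1 ↔ s ≤ 1 + c := lt_add_one_iff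
  have hS : 1 + c ≠ 0 := by rw [add_comm]; exact add_one_ne_zero c
  have hpos : (0 : M.Num) < 1 + c + 1 := hlt.2 zero_le
  -- The invariant: at stage 0 the vertex is (k,a); later it is some (i,b) with i = H(s) that is
  -- adjacent to (k,a).
  obtain ⟨I, -, hI⟩ := exists_set
    (φ := exLt 1 (.var 0 + 1) fun s => exLt 2 (.var 0 + 1) fun u => eqN (.var 0) (pair s u) ⋏
      ((eqN s 0 ⋏ eqN u (pair (.var 3) (.var 4))) ⋎
        (neg (eqN s 0) ⋏ exLt 5 (.var 7) fun i => exLt 6 (.var 8) fun b =>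
          eqN u (pair i b) ⋏ mem2 0 s i ⋏ edge 1 (.var 3) i (.var 4) b)))
    (by simp) 0 (update (update (update (fun _ => l) 3 k) 4 a) 7 n) (update (fun _ => H) 1 E)
    (npair (1 + c + 1) (npair n l))
  -- The transition relation is E itself, copied to every stage.
  obtain ⟨T, -, hT⟩ := exists_set
    (φ := exLt 1 (.var 0 + 1) fun s => exLt 2 (.var 0 + 1) fun u => exLt 3 (.var 0 + 1) fun v =>
      eqN (.var 0) (pair s (pair u v)) ⋏ mem2 0 u v)
    (by simp) 0 (fun _ => 0) (fun _ => E) (npair (1 + c + 1) (npair (npair n l) (npair n l)))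
  simp [lt_add_one_iff] at hI hT
  have hI' {s u : M.Num} (hs : s ≤ 1 + c) (hu : u < npair n l) : M.mem (npair s u) I ↔
      (s = 0 ∧ u = npair k a) ∨ (s ≠ 0 ∧ ∃ i < n, ∃ b < l, u = npair i b ∧
        M.mem (npair s i) H ∧ Edge E k i a b) := by
    rw [hI]
    constructor
    · rintro ⟨-, s', -, u', -, he, h⟩
      obtain ⟨rfl, rfl⟩ := npair_inj.1 he
      exact h
    · exact fun h => ⟨npair_lt_npair (hlt.2 hs) hu.le, s, le_npair_left _ _, u,
        le_npair_right _ _, rfl, h⟩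
  have hT' {s u v : M.Num} (hs : s ≤ 1 + c) (hu : u < npair n l) (hv : v < npair n l) :
      M.mem (npair s (npair u v)) T ↔ M.mem (npair u v) E := by
    rw [hT]
    constructor
    · rintro ⟨-, s', -, u', -, v', -, he, h⟩
      simp only [npair_inj] at he
      obtain ⟨rfl, rfl, rfl⟩ := he
      exact h
    · exact fun h => ⟨npair_lt_npair (hlt.2 hs) (npair_le_npair hu.le hv.le), s, le_npair_left _ _,
        u, (le_npair_left _ _).trans (le_npair_right _ _), v,
        (le_npair_right _ _).trans (le_npair_right _ _), rfl, h⟩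
  have hkal : npair k a < npair n l := npair_lt_npair hk ha.le
  obtain ⟨H', h1, h2, h3, h4, h5, h6, h7⟩ := exists_path I T (S := 1 + c) (N := npair n l)
    (B := npair (1 + c + 1) (npair n l)) (u₀ := npair k a)
    (fun s hs u hu => npair_lt_npair (hlt.2 hs) hu.le) hkal
    ((hI' zero_le hkal).2 (.inl ⟨rfl, rfl⟩))
    (by
      intro s hs u hu hsu
      have hs1 := add_one_le_iff.2 hs
      obtain ⟨i', hi', hHi'⟩ := hH.1 (s + 1) (hlt.2 hs1)
      rcases (hI' hs.le hu).1 hsu with ⟨rfl, rfl⟩ | ⟨hs0, i, hi, b, hb, rfl, hsi, he⟩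
      · have hEX : M.mem (npair k i') EX ∨ M.mem (npair i' k) EX :=
          (hC.2.2.1 0 hpos (hlt.2 hs1)).imp
            (fun h => hH.2.2 _ hpos _ (hlt.2 hs1) _ hk _ hi' ⟨h, hHk, hHi'⟩)
            (fun h => hH.2.2 _ (hlt.2 hs1) _ hpos _ hi' _ hk ⟨h, hHi', hHk⟩)
        obtain ⟨b, hb, he⟩ := h.extend k hk a ha hka i' hi' hEX
        have hib := npair_lt_npair hi' hb.le
        exact ⟨npair i' b, hib, (hI' hs1 hib).2 (.inr ⟨add_one_ne_zero _, i', hi', b, hb, rfl,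
          hHi', he⟩), (hT' hs.le hu hib).2 he⟩
      -- Complete the edge from (k,a) to (i,b) to a triangle over i' = H(s + 1): one new side keeps
      -- the invariant, the other is the transition.
      · obtain ⟨d, hd, he1, he2⟩ := h.closed k hk i hi a ha b hb he i' hi'
        have hid := npair_lt_npair hi' hd.le
        exact ⟨npair i' d, hid, (hI' hs1 hid).2 (.inr ⟨add_one_ne_zero _, i', hi', d, hd, rfl,
          hHi', he1⟩), (hT' hs.le hu hid).2 (h.symm _ _ he2)⟩)
  have hval {s u : M.Num} (hs : s ≤ 1 + c) (hu : u < npair n l) (hsu : M.mem (npair s u) H') :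
      ∃ i < n, ∃ b < l, u = npair i b ∧ M.mem (npair s i) H ∧ M.mem u V := by
    rcases (hI' hs hu).1 (h6 _ hsu) with ⟨rfl, rfl⟩ | ⟨-, i, hi, b, hb, rfl, hsi, he⟩
    · exact ⟨k, hk, a, ha, rfl, hHk, hka⟩
    · exact ⟨i, hi, b, hb, rfl, hsi, (h.dom _ _ he).2⟩
  have hlast {u u' : M.Num} (hu : M.mem (npair 0 u) H') (hul : u' < npair n l)
      (hu' : M.mem (npair (1 + c) u') H') : M.mem (npair u u') E := by
    obtain rfl := h5 _ _ _ hu h3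
    rcases (hI' le_rfl hul).1 (h6 _ hu') with ⟨h0, -⟩ | ⟨-, i, hi, b, hb, rfl, -, he⟩
    · exact absurd h0 hS
    · exact he
  refine ⟨H', h1, ⟨fun i hi => ?_, fun i _ u _ u' _ hu => h5 i u u' hu.1 hu.2,
    fun i hi i' hi' u hu u' hu' ⟨hEC, hiu, hiu'⟩ => ?_⟩, fun i hi j hj hji => ?_, h3⟩
  · obtain ⟨u, hu, hiu⟩ := h4 i (hlt.1 hi)
    obtain ⟨_, _, _, _, _, _, hV⟩ := hval (hlt.1 hi) hu hiu
    exact ⟨u, hu, hV, hiu⟩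
  · rcases hC.2.2.2 i hi i' hi' hEC with rfl | rfl | ⟨rfl, he⟩ | ⟨rfl, he⟩
    · exact (hT' (hlt.1 hi) hu hu').1 (h7 _ _ _ hiu hiu')
    · exact h.symm _ _ ((hT' (hlt.1 hi') hu' hu).1 (h7 _ _ _ hiu' hiu))
    · obtain rfl := add_one_inj he
      exact hlast hiu hu' hiu'
    · obtain rfl := add_one_inj he
      exact h.symm _ _ (hlast hiu' hu hiu)
  · obtain ⟨u, hu, hju⟩ := h4 j (hlt.1 hj)
    obtain ⟨i', hi', b, hb, rfl, hji', hV⟩ := hval (hlt.1 hj) hu hju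
    obtain rfl := hH.2.1 j hj i hi i' hi' ⟨hji, hji'⟩
    exact ⟨b, hb, hV, hju⟩

/-- In the existence half the census precedes the propagation, since its final value q fixes how
many rows are computed. -/
theorem valid_ccLemma : M.Valid ccLemma := by
  intro σ τ
  simp only [ccLemma, isPropagated, realize_allN, realize_allS, realize_exN, realize_exS,
    realize_imp, realize_and, realize_isR1, realize_isCensus, realize_mem2, realize_isPropagation,
    realize_isAcc, realize_cycleConsistent, eval_var, eval_len]
  simp
  intro n l EX V E _
  constructor
  · obtain ⟨V₁, E₁, h₁⟩ := exists_isR1 n l EX V E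
    obtain ⟨C, q, hC, hq⟩ := exists_census E₁
    obtain ⟨R, hR⟩ := exists_isPropagation n l q V₁ E₁
    obtain ⟨Vcc, Ecc, h⟩ := exists_isAcc n l q EX V₁ R
    exact ⟨q, V₁, E₁, h₁, C, hC, hq, R, hR, Vcc, Ecc, h⟩
  · intro q V₁ E₁ C R Vcc Ecc h₁ hC hq hR h _
    exact (h.saturated h₁ hC hq hR).cycleConsistent

end Model

end BoundedArith

theorem mainTheorem3 : BoundedArith.Proves.{u, v} BoundedArith.V1 BoundedArith.ccLemma := by
  intro M hM
  have : BoundedArith.IsModelV1 M := ⟨hM⟩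
  exact BoundedArith.Model.valid_ccLemma
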